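/- Let $k$ be a commutative ring, $A$ and $L$ associative unital $k$-algebras, $\mathcal C$ an $A$-coring (an $A$-$A$ bimodule with coassociative counital $A$-bilinear coproduct $\Delta$ and counit $\epsilon$) and $\mathcal D$ an $L$-coring. Write $\mathcal M^{\mathcal C}$ for the category of right $\mathcal C$-comodules and $m\mapsto m^{[0]}\otimes_A m^{[1]}$ for their coactions $\varrho$. Assume that $\mathcal D$ is a *right extension* of $\mathcal C$: $\mathcal C$ also carries a right $L$-action commuting with the left $A$-action, for which $\Delta$ is right $L$-linear, and a left $A$-linear right $\mathcal D$-coaction $\tau:c\mapsto c_{[0]}\otimes_L c_{[1]}$ for which $\Delta$ is right $\mathcal D$-colinear. Every $M\in\mathcal M^{\mathcal C}$ is then a right $L$-module by $ml=m^{[0]}\epsilon(m^{[1]}l)$. Assume that the extension is *pure*: for every right $\mathcal C$-comodule $M$ the equaliser $$M\xrightarrow{\ \varrho\ }M\otimes_A\mathcal C\rightrightarrows M\otimes_A\mathcal C\otimes_A\mathcal C$$ of $\varrho\otimes_A\mathcal C$ and $M\otimes_A\Delta$ in the category of right $L$-modules is preserved by $-\otimes_L\mathcal D\otimes_L\mathcal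 D$. Then $M$ has a right $\mathcal D$-coaction $\tau_M:M\to M\otimes_L\mathcal D$, the unique map with $(\varrho\otimes_L\mathcal D)\tau_M=(M\otimes_A\tau)\varrho$. Let $\Sigma$ be an $L$-$\mathcal C$ bicomodule (a left $L$-module and right $\mathcal C$-comodule with left $L$-linear coaction), and let $T=\mathrm{End}^{\mathcal C}(\Sigma)$, an $L$-ring via $l\mapsto(x\mapsto lx)$. Let $\Sigma^*=\mathrm{Hom}_A(\Sigma,A)$ with $(a\xi l)(x)=a\,\xi(lx)$, and let $$\widetilde Q=\{q\in{}_A\mathrm{Hom}_L(\mathcal C,\Sigma^*)\mid c^{(1)}q(c^{(2)})(x)=q(c)(x^{[0]})x^{[1]}\ \text{for all } x\in\Sigma,\ c\in\mathcal C\}.$$ The Morita context $\widetilde{\mathbb M}(\Sigma)$ connects the algebras ${}_L\mathrm{Hom}_L(\mathcal D,T)$ and ${}^{\mathcal C}\mathrm{End}^{\mathcal D}(\mathcal C)^{op}$ by the bimodules ${}_L\mathrm{Hom}^{\mathcal D}(\mathcal D,\Sigma)$ and $\widetilde Q$; its connecting maps $\widetilde Q\otimes{}_L\mathrm{Hom}^{\mathcal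 D}(\mathcal D,\Sigma)\to{}^{\mathcal C}\mathrm{End}^{\mathcal D}(\mathcal C)^{op}$ and ${}_L\mathrm{Hom}^{\mathcal D}(\mathcal D,\Sigma)\otimes\widetilde Q\to{}_L\mathrm{Hom}_L(\mathcal D,T)$ (tensor products over the respective algebras) are $$q\otimes p\mapsto\big(c\mapsto q(c_{[0]})(p(c_{[1]})^{[0]})\,p(c_{[1]})^{[1]}\big),\qquad p\otimes q\mapsto\big(d\mapsto p(d)^{[0]}\,q(p(d)^{[1]})(-)\big).$$ **Strong Structure Theorem.** Suppose that $\widetilde{\mathbb M}(\Sigma)$ is strict, i.e. both connecting maps are surjective, and that there are finitely many elements $v_j\in{}_L\mathrm{Hom}_L(\mathcal D,T)$ and $d_j\in\mathcal D$ with $\sum_j v_j(d_j)=1_T$. Then the functors $-\otimes_T\Sigma:\mathcal M_T\to\mathcal M^{\mathcal C}$ and $\mathrm{Hom}^{\mathcal C}(\Sigma,-):\mathcal M^{\mathcal C}\to\mathcal M_T$ are inverse equivalences. -/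

import Mathlib

open CategoryTheory MulOpposite

universe u

noncomputable section

namespace CoringExt

/-! ## Balanced tensor products over a possibly noncommutative ring

A right `R`-module is a `Module Rᵐᵒᵖ M`, with `op r • m` for `m r`; an `R`-`S` bimodule carries
commuting actions of `R` and of `Sᵐᵒᵖ`. -/

section BTensor

open TensorProduct in
/-- The subgroup of `M ⊗ N` generated by the elements `m r ⊗ n - m ⊗ r n`. -/
def balancing (R : Type*) [Ring R] (M : Type*) [AddCommGroup M] [Module Rᵐᵒᵖ M]
    (N : Type*) [AddCommGroup N] [Module R N] : AddSubgroup (M ⊗[ℤ] N) :=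
  AddSubgroup.closure {z | ∃ (m : M) (r : R) (n : N),
    z = (op r • m) ⊗ₜ[ℤ] n - m ⊗ₜ[ℤ] (r • n)}

open TensorProduct in
/-- The tensor product over `R` of a right `R`-module `M` and a left `R`-module `N`. -/
def BTensor (R : Type*) [Ring R] (M : Type*) [AddCommGroup M] [Module Rᵐᵒᵖ M]
    (N : Type*) [AddCommGroup N] [Module R N] : Type _ :=
  (M ⊗[ℤ] N) ⧸ balancing R M N

notation:100 M:100 " ⊗ᴮ[" R "] " N:101 => BTensor R M N

variable {R S : Type*} [Ring R] [Ring S]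
variable {M M' M'' N N' N'' P : Type*}
  [AddCommGroup M] [Module Rᵐᵒᵖ M] [AddCommGroup M'] [Module Rᵐᵒᵖ M']
  [AddCommGroup M''] [Module Rᵐᵒᵖ M'']
  [AddCommGroup N] [Module R N] [AddCommGroup N'] [Module R N']
  [AddCommGroup N''] [Module R N''] [AddCommGroup P]

instance : AddCommGroup (M ⊗ᴮ[R] N) :=
  inferInstanceAs (AddCommGroup ((TensorProduct ℤ M N) ⧸ balancing R M N))

namespace BTensor

variable (R) in
/-- The pure tensor `m ⊗ n`. -/
def tmul (m : M) (n : N) : M ⊗ᴮ[R] N :=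
  QuotientAddGroup.mk (TensorProduct.tmul ℤ m n)

theorem add_tmul (m m' : M) (n : N) : tmul R (m + m') n = tmul R m n + tmul R m' n :=
  congrArg QuotientAddGroup.mk (TensorProduct.add_tmul m m' n)

theorem tmul_add (m : M) (n n' : N) : tmul R m (n + n') = tmul R m n + tmul R m n' :=
  congrArg QuotientAddGroup.mk (TensorProduct.tmul_add m n n')

theorem smul_tmul (r : R) (m : M) (n : N) : tmul R (op r • m) n = tmul R m (r • n) :=
  (QuotientAddGroup.eq_iff_sub_mem (N := balancing R M N)).2
    (AddSubgroup.subset_closure ⟨m, r, n, rfl⟩)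

/-- The map out of the tensor product induced by a balanced biadditive map. -/
def lift (f : M → N → P) (h₁ : ∀ m m' n, f (m + m') n = f m n + f m' n)
    (h₂ : ∀ m n n', f m (n + n') = f m n + f m n')
    (h₃ : ∀ (r : R) m n, f (op r • m) n = f m (r • n)) : M ⊗ᴮ[R] N →+ P :=
  QuotientAddGroup.lift (balancing R M N)
    (TensorProduct.liftAddHom (R := ℤ)
      (AddMonoidHom.mk' (fun m => AddMonoidHom.mk' (f m) (h₂ m))
        (fun a b => AddMonoidHom.ext (h₁ a b)))
      (fun r m n => by rw [map_zsmul, map_zsmul]; rfl)) (by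
      refine (AddSubgroup.closure_le _).2 ?_
      rintro _ ⟨m, r, n, rfl⟩
      refine (AddMonoidHom.mem_ker).2 ?_
      rw [map_sub]
      exact sub_eq_zero.2 (h₃ r m n))

@[simp] theorem lift_tmul (f : M → N → P) (h₁ h₂ h₃) (m : M) (n : N) :
    lift (R := R) f h₁ h₂ h₃ (tmul R m n) = f m n := rfl

theorem zero_tmul (n : N) : tmul R (0 : M) n = 0 := by
  have : tmul R (0 : M) n + tmul R (0 : M) n = tmul R (0 : M) n := by
    rw [← add_tmul, add_zero]
  simpa using this

theorem tmul_zero (m : M) : tmul R m (0 : N) = 0 := by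
  have : tmul R m (0 : N) + tmul R m (0 : N) = tmul R m (0 : N) := by
    rw [← tmul_add, add_zero]
  simpa using this

@[elab_as_elim]
theorem induction_on {motive : M ⊗ᴮ[R] N → Prop} (z : M ⊗ᴮ[R] N)
    (tm : ∀ m n, motive (tmul R m n))
    (plus : ∀ x y, motive x → motive y → motive (x + y)) : motive z := by
  obtain ⟨t, rfl⟩ := QuotientAddGroup.mk_surjective z
  induction t with
  | zero =>
    have h := tm 0 0
    rw [zero_tmul] at h
    exact h
  | tmul x y => exact tm x y
  | add x y hx hy => exact plus _ _ hx hy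

theorem hom_ext {f g : M ⊗ᴮ[R] N →+ P} (h : ∀ m n, f (tmul R m n) = g (tmul R m n)) : f = g := by
  ext z
  induction z using induction_on with
  | tm m n => exact h m n
  | plus x y hx hy => rw [map_add, map_add, hx, hy]

/-- The tensor product `f ⊗ g` of a right linear and a left linear map. -/
def map (f : M →ₗ[Rᵐᵒᵖ] M') (g : N →ₗ[R] N') : M ⊗ᴮ[R] N →+ M' ⊗ᴮ[R] N' :=
  lift (fun m n => tmul R (f m) (g n)) (fun a b n => by rw [map_add, add_tmul])
    (fun m a b => by rw [map_add, tmul_add])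
    (fun r m n => by rw [map_smul, map_smul, smul_tmul])

@[simp] theorem map_tmul (f : M →ₗ[Rᵐᵒᵖ] M') (g : N →ₗ[R] N') (m : M) (n : N) :
    map f g (tmul R m n) = tmul R (f m) (g n) := rfl

theorem map_map (f' : M' →ₗ[Rᵐᵒᵖ] M'') (g' : N' →ₗ[R] N'') (f : M →ₗ[Rᵐᵒᵖ] M')
    (g : N →ₗ[R] N') (z : M ⊗ᴮ[R] N) :
    map f' g' (map f g z) = map (f' ∘ₗ f) (g' ∘ₗ g) z := by
  induction z using induction_on with
  | tm m n => rfl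
  | plus x y hx hy => simp only [map_add, hx, hy]

@[simp] theorem map_id (z : M ⊗ᴮ[R] N) :
    map (LinearMap.id : M →ₗ[Rᵐᵒᵖ] M) (LinearMap.id : N →ₗ[R] N) z = z := by
  induction z using induction_on with
  | tm m n => rfl
  | plus x y hx hy => simp only [map_add, hx, hy]

theorem map_add_left (f f' : M →ₗ[Rᵐᵒᵖ] M') (g : N →ₗ[R] N') (z : M ⊗ᴮ[R] N) :
    map (f + f') g z = map f g z + map f' g z := by
  induction z using induction_on with
  | tm m n => rw [map_tmul, LinearMap.add_apply, add_tmul]; rfl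
  | plus x y hx hy => simp only [map_add, hx, hy]; abel

theorem map_add_right (f : M →ₗ[Rᵐᵒᵖ] M') (g g' : N →ₗ[R] N') (z : M ⊗ᴮ[R] N) :
    map f (g + g') z = map f g z + map f g' z := by
  induction z using induction_on with
  | tm m n => rw [map_tmul, LinearMap.add_apply, tmul_add]; rfl
  | plus x y hx hy => simp only [map_add, hx, hy]; abel

/-- `f ⊗ g`, as an additive function of `f`. -/
def mapLeftHom (g : N →ₗ[R] N') (z : M ⊗ᴮ[R] N) : (M →ₗ[Rᵐᵒᵖ] M') →+ M' ⊗ᴮ[R] N' :=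
  AddMonoidHom.mk' (fun f => map f g z) (fun f f' => map_add_left f f' g z)

/-- `f ⊗ g`, as an additive function of `g`. -/
def mapRightHom (f : M →ₗ[Rᵐᵒᵖ] M') (z : M ⊗ᴮ[R] N) : (N →ₗ[R] N') →+ M' ⊗ᴮ[R] N' :=
  AddMonoidHom.mk' (fun g => map f g z) (fun g g' => map_add_right f g g' z)

@[simp] theorem mapLeftHom_apply (f : M →ₗ[Rᵐᵒᵖ] M') (g : N →ₗ[R] N') (z : M ⊗ᴮ[R] N) :
    mapLeftHom g z f = map f g z := rfl

@[simp] theorem mapRightHom_apply (f : M →ₗ[Rᵐᵒᵖ] M') (g : N →ₗ[R] N') (z : M ⊗ᴮ[R] N) :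
    mapRightHom f z g = map f g z := rfl

/-- Left multiplication by `s`, on a module where it commutes with the right action of `R`. -/
def smulHom (R : Type*) [Ring R] {M : Type*} [AddCommGroup M] [Module R M]
    {S : Type*} [Ring S] [Module S M] [SMulCommClass S R M] (s : S) : M →ₗ[R] M where
  toFun m := s • m
  map_add' := smul_add s
  map_smul' r m := smul_comm s r m

@[simp] theorem smulHom_apply {M : Type*} [AddCommGroup M] [Module R M]
    [Module S M] [SMulCommClass S R M] (s : S) (m : M) : smulHom R s m = s • m := rfl

/-- A left action on the first factor acts on the tensor product. -/
instance leftModule [Module S M] [SMulCommClass S Rᵐᵒᵖ M] : Module S (M ⊗ᴮ[R] N) where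
  smul s z := map (smulHom Rᵐᵒᵖ s) LinearMap.id z
  one_smul z := by
    change map (smulHom Rᵐᵒᵖ (1 : S)) LinearMap.id z = z
    induction z using induction_on with
    | tm m n => simp
    | plus x y hx hy => simp only [map_add, hx, hy]
  mul_smul s t z := by
    change map (smulHom Rᵐᵒᵖ (s * t)) LinearMap.id z =
      map (smulHom Rᵐᵒᵖ s) LinearMap.id (map (smulHom Rᵐᵒᵖ t) LinearMap.id z)
    induction z using induction_on with
    | tm m n => simp [mul_smul]
    | plus x y hx hy => simp only [map_add, hx, hy]
  smul_zero s := map_zero _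
  smul_add s := map_add _
  add_smul s t z := by
    change map (smulHom Rᵐᵒᵖ (s + t)) LinearMap.id z =
      map (smulHom Rᵐᵒᵖ s) LinearMap.id z + map (smulHom Rᵐᵒᵖ t) LinearMap.id z
    induction z using induction_on with
    | tm m n => simp [add_smul, add_tmul]
    | plus x y hx hy => simp only [map_add, hx, hy]; abel
  zero_smul z := by
    change map (smulHom Rᵐᵒᵖ (0 : S)) LinearMap.id z = 0
    induction z using induction_on with
    | tm m n => simp [zero_tmul]
    | plus x y hx hy => simp only [map_add, hx, hy, add_zero]

/-- A right action on the second factor acts on the tensor product. -/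
instance rightModule [Module Sᵐᵒᵖ N] [SMulCommClass R Sᵐᵒᵖ N] : Module Sᵐᵒᵖ (M ⊗ᴮ[R] N) :=
  letI (s : Sᵐᵒᵖ) : N →ₗ[R] N :=
    haveI : SMulCommClass Sᵐᵒᵖ R N := SMulCommClass.symm _ _ _
    smulHom R s
  { smul := fun s z => map LinearMap.id (this s) z
    one_smul := fun z => by
      change map LinearMap.id (this 1) z = z
      induction z using induction_on with
      | tm m n => simp [this]
      | plus x y hx hy => simp only [map_add, hx, hy]
    mul_smul := fun s t z => by
      change map LinearMap.id (this (s * t)) z =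
        map LinearMap.id (this s) (map LinearMap.id (this t) z)
      induction z using induction_on with
      | tm m n => simp [this, mul_smul]
      | plus x y hx hy => simp only [map_add, hx, hy]
    smul_zero := fun s => map_zero _
    smul_add := fun s => map_add _
    add_smul := fun s t z => by
      change map LinearMap.id (this (s + t)) z =
        map LinearMap.id (this s) z + map LinearMap.id (this t) z
      induction z using induction_on with
      | tm m n => simp [this, add_smul, tmul_add]
      | plus x y hx hy => simp only [map_add, hx, hy]; abel
    zero_smul := fun z => by
      change map LinearMap.id (this 0) z = 0
      induction z using induction_on with
      | tm m n => simp [this, tmul_zero]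
      | plus x y hx hy => simp only [map_add, hx, hy, add_zero] }

theorem left_smul_tmul [Module S M] [SMulCommClass S Rᵐᵒᵖ M] (s : S) (m : M) (n : N) :
    s • tmul R m n = tmul R (s • m) n := rfl

theorem right_smul_tmul [Module Sᵐᵒᵖ N] [SMulCommClass R Sᵐᵒᵖ N] (s : Sᵐᵒᵖ) (m : M) (n : N) :
    s • tmul R m n = tmul R m (s • n) := rfl

instance bimodule {S' : Type*} [Ring S'] [Module S M] [SMulCommClass S Rᵐᵒᵖ M]
    [Module S'ᵐᵒᵖ N] [SMulCommClass R S'ᵐᵒᵖ N] : SMulCommClass S S'ᵐᵒᵖ (M ⊗ᴮ[R] N) where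
  smul_comm s t z := by
    induction z using induction_on with
    | tm m n => rfl
    | plus x y hx hy => simp only [smul_add, hx, hy]

/-- `f ⊗ g` as a left `S`-linear map. -/
def mapL [Module S M] [SMulCommClass S Rᵐᵒᵖ M] [Module S M'] [SMulCommClass S Rᵐᵒᵖ M']
    (f : M →ₗ[Rᵐᵒᵖ] M') (g : N →ₗ[R] N') (hf : ∀ (s : S) m, f (s • m) = s • f m) :
    M ⊗ᴮ[R] N →ₗ[S] M' ⊗ᴮ[R] N' where
  toFun := map f g
  map_add' := map_add _
  map_smul' s z := by
    induction z using induction_on with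
    | tm m n => simp [left_smul_tmul, hf]
    | plus x y hx hy => simp only [map_add, smul_add, hx, hy]

/-- `f ⊗ g` as a right `S`-linear map. -/
def mapR [Module Sᵐᵒᵖ N] [SMulCommClass R Sᵐᵒᵖ N] [Module Sᵐᵒᵖ N'] [SMulCommClass R Sᵐᵒᵖ N']
    (f : M →ₗ[Rᵐᵒᵖ] M') (g : N →ₗ[R] N') (hg : ∀ (s : Sᵐᵒᵖ) n, g (s • n) = s • g n) :
    M ⊗ᴮ[R] N →ₗ[Sᵐᵒᵖ] M' ⊗ᴮ[R] N' where
  toFun := map f g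
  map_add' := map_add _
  map_smul' s z := by
    induction z using induction_on with
    | tm m n => simp [right_smul_tmul, hg]
    | plus x y hx hy => simp only [map_add, smul_add, hx, hy]

@[simp] theorem mapL_apply [Module S M] [SMulCommClass S Rᵐᵒᵖ M] [Module S M']
    [SMulCommClass S Rᵐᵒᵖ M'] (f : M →ₗ[Rᵐᵒᵖ] M') (g : N →ₗ[R] N')
    (hf : ∀ (s : S) m, f (s • m) = s • f m) (z) : mapL f g hf z = map f g z := rfl

@[simp] theorem mapR_apply [Module Sᵐᵒᵖ N] [SMulCommClass R Sᵐᵒᵖ N] [Module Sᵐᵒᵖ N']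
    [SMulCommClass R Sᵐᵒᵖ N'] (f : M →ₗ[Rᵐᵒᵖ] M') (g : N →ₗ[R] N')
    (hg : ∀ (s : Sᵐᵒᵖ) n, g (s • n) = s • g n) (z) : mapR f g hg z = map f g z := rfl

section Assoc

variable {Q : Type*} [AddCommGroup Q] [Module S Q] [Module Sᵐᵒᵖ N] [SMulCommClass R Sᵐᵒᵖ N]

/-- For fixed `q`, the map `m ⊗ n ↦ m ⊗ (n ⊗ q)`. -/
def assocHomAux (q : Q) : M ⊗ᴮ[R] N →+ M ⊗ᴮ[R] (N ⊗ᴮ[S] Q) :=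
  lift (fun m n => tmul R m (tmul S n q)) (fun a b n => add_tmul _ _ _)
    (fun m a b => by rw [add_tmul, tmul_add])
    (fun r m n => by rw [smul_tmul, left_smul_tmul])

/-- `(m ⊗ n) ⊗ q ↦ m ⊗ (n ⊗ q)`. -/
def assocHom : (M ⊗ᴮ[R] N) ⊗ᴮ[S] Q →+ M ⊗ᴮ[R] (N ⊗ᴮ[S] Q) :=
  lift (fun z q => assocHomAux q z) (fun a b q => map_add _ _ _)
    (fun z a b => by
      induction z using induction_on with
      | tm m n => simp only [assocHomAux, lift_tmul, tmul_add]
      | plus x y hx hy => simp only [map_add, hx, hy]; abel)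
    (fun s z q => by
      induction z using induction_on with
      | tm m n => rw [right_smul_tmul]; simp only [assocHomAux, lift_tmul, smul_tmul]
      | plus x y hx hy => simp only [map_add, smul_add, hx, hy])

/-- For fixed `m`, the map `n ⊗ q ↦ (m ⊗ n) ⊗ q`. -/
def assocInvAux (m : M) : N ⊗ᴮ[S] Q →+ (M ⊗ᴮ[R] N) ⊗ᴮ[S] Q :=
  lift (fun n q => tmul S (tmul R m n) q) (fun a b q => by rw [tmul_add, add_tmul])
    (fun n a b => tmul_add _ _ _)
    (fun s n q => by rw [← smul_tmul, right_smul_tmul])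

/-- `m ⊗ (n ⊗ q) ↦ (m ⊗ n) ⊗ q`. -/
def assocInv : M ⊗ᴮ[R] (N ⊗ᴮ[S] Q) →+ (M ⊗ᴮ[R] N) ⊗ᴮ[S] Q :=
  lift (fun m z => assocInvAux m z)
    (fun a b z => by
      induction z using induction_on with
      | tm n q => simp only [assocInvAux, lift_tmul, add_tmul]
      | plus x y hx hy => simp only [map_add, hx, hy]; abel)
    (fun m a b => map_add _ _ _)
    (fun r m z => by
      induction z using induction_on with
      | tm n q => rw [left_smul_tmul]; simp only [assocInvAux, lift_tmul, smul_tmul]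
      | plus x y hx hy => simp only [map_add, smul_add, hx, hy])

/-- The associativity isomorphism `(M ⊗ N) ⊗ Q ≃ M ⊗ (N ⊗ Q)`. -/
def assoc : (M ⊗ᴮ[R] N) ⊗ᴮ[S] Q ≃+ M ⊗ᴮ[R] (N ⊗ᴮ[S] Q) where
  toFun := assocHom
  invFun := assocInv
  left_inv z := by
    suffices h : assocInv.comp assocHom = AddMonoidHom.id ((M ⊗ᴮ[R] N) ⊗ᴮ[S] Q) from
      DFunLike.congr_fun h z
    apply hom_ext
    intro t q
    induction t using induction_on with
    | tm m n => rfl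
    | plus x y hx hy => rw [add_tmul, map_add, map_add, hx, hy]
  right_inv z := by
    suffices h : assocHom.comp assocInv = AddMonoidHom.id (M ⊗ᴮ[R] (N ⊗ᴮ[S] Q)) from
      DFunLike.congr_fun h z
    apply hom_ext
    intro m t
    induction t using induction_on with
    | tm n q => rfl
    | plus x y hx hy => rw [tmul_add, map_add, map_add, hx, hy]
  map_add' := map_add _

@[simp] theorem assoc_tmul (m : M) (n : N) (q : Q) :
    assoc (tmul S (tmul R m n) q) = tmul R m (tmul S n q) := rfl

@[simp] theorem assoc_symm_tmul (m : M) (n : N) (q : Q) :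
    assoc.symm (tmul R m (tmul S n q)) = tmul S (tmul R m n) q := rfl

theorem assoc_map_left (f : M →ₗ[Rᵐᵒᵖ] M') (z : (M ⊗ᴮ[R] N) ⊗ᴮ[S] Q) :
    assoc (map (mapR f (LinearMap.id : N →ₗ[R] N) (S := S) (fun _ _ => rfl)) LinearMap.id z) =
      map f LinearMap.id (assoc z) := by
  induction z using induction_on with
  | tm t q =>
    induction t using induction_on with
    | tm m n => rfl
    | plus x y hx hy => simp only [add_tmul, map_add, hx, hy]
  | plus x y hx hy => simp only [map_add, hx, hy]

end Assoc

/-- The isomorphism `M ⊗ R → M`, `m ⊗ r ↦ m r`. -/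
def rid : M ⊗ᴮ[R] R →+ M :=
  lift (fun m r => op r • m) (fun a b r => smul_add _ _ _)
    (fun m a b => by rw [MulOpposite.op_add, add_smul])
    (fun r m s => by rw [smul_eq_mul, op_mul, mul_smul])

/-- The isomorphism `R ⊗ N → N`, `r ⊗ n ↦ r n`. -/
def lid : R ⊗ᴮ[R] N →+ N :=
  lift (fun r n => r • n) (fun a b n => add_smul _ _ _) (fun r a b => smul_add _ _ _)
    (fun r m s => by rw [op_smul_eq_mul, mul_smul])

@[simp] theorem rid_tmul (m : M) (r : R) : rid (tmul R m r) = op r • m := rfl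

@[simp] theorem lid_tmul (r : R) (n : N) : lid (tmul R r n) = r • n := rfl

theorem rid_map (f : M →ₗ[Rᵐᵒᵖ] M') (z : M ⊗ᴮ[R] R) : rid (map f LinearMap.id z) = f (rid z) := by
  induction z using induction_on with
  | tm m r => rw [map_tmul, rid_tmul, rid_tmul, map_smul]; rfl
  | plus x y hx hy => simp only [map_add, hx, hy]

end BTensor

end BTensor

/-! ## Bimodule maps and corings -/

/-- The group of maps of `R`-`S` bimodules: additive, left `R`-linear and right `S`-linear. -/
def bimodHom (R S M N : Type*) [Ring R] [Ring S] [AddCommGroup M] [Module R M]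
    [Module Sᵐᵒᵖ M] [AddCommGroup N] [Module R N] [Module Sᵐᵒᵖ N] : AddSubgroup (M →+ N) where
  carrier := {f | (∀ (r : R) (m : M), f (r • m) = r • f m) ∧
    ∀ (s : S) (m : M), f (op s • m) = op s • f m}
  zero_mem' := ⟨fun r m => (smul_zero r).symm, fun s m => (smul_zero (op s)).symm⟩
  add_mem' {f g} hf hg := ⟨fun r m => by simp [hf.1, hg.1], fun s m => by simp [hf.2, hg.2]⟩
  neg_mem' {f} hf := ⟨fun r m => by simp [hf.1], fun s m => by simp [hf.2]⟩

/-- Maps of `R`-`S` bimodules. -/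
abbrev BimodHom (R S M N : Type*) [Ring R] [Ring S] [AddCommGroup M] [Module R M]
    [Module Sᵐᵒᵖ M] [AddCommGroup N] [Module R N] [Module Sᵐᵒᵖ N] : Type _ :=
  bimodHom R S M N

namespace BimodHom

variable {R S M N : Type*} [Ring R] [Ring S] [AddCommGroup M] [Module R M]
    [Module Sᵐᵒᵖ M] [AddCommGroup N] [Module R N] [Module Sᵐᵒᵖ N]

instance : CoeFun (BimodHom R S M N) (fun _ => M → N) := ⟨fun f => f.1⟩

/-- The underlying left linear map. -/
def l (f : BimodHom R S M N) : M →ₗ[R] N where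
  toFun := f
  map_add' := map_add f.1
  map_smul' := f.2.1

/-- The underlying right linear map. -/
def r (f : BimodHom R S M N) : M →ₗ[Sᵐᵒᵖ] N where
  toFun := f
  map_add' := map_add f.1
  map_smul' s m := f.2.2 s.unop m

@[simp] theorem l_apply (f : BimodHom R S M N) (m : M) : f.l m = f m := rfl

@[simp] theorem r_apply (f : BimodHom R S M N) (m : M) : f.r m = f m := rfl

/-- `BimodHom.l` as an additive map. -/
def lHom : BimodHom R S M N →+ (M →ₗ[R] N) := AddMonoidHom.mk' l (fun _ _ => rfl)

/-- `BimodHom.r` as an additive map. -/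
def rHom : BimodHom R S M N →+ (M →ₗ[Sᵐᵒᵖ] N) := AddMonoidHom.mk' r (fun _ _ => rfl)

end BimodHom

open BTensor

/-- An `A`-coring: an `A`-`A` bimodule `C` with a coassociative coproduct and a counit, both of
them `A`-`A` bilinear. -/
class Coring (A C : Type*) [Ring A] [AddCommGroup C] [Module A C] [Module Aᵐᵒᵖ C]
    [SMulCommClass A Aᵐᵒᵖ C] where
  comul : BimodHom A A C (C ⊗ᴮ[A] C)
  counit : BimodHom A A C A
  coassoc : ∀ c : C, assoc (map comul.r LinearMap.id (comul c)) =
    map LinearMap.id comul.l (comul c)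
  counit_comul : ∀ c : C, lid (map counit.r LinearMap.id (comul c)) = c
  comul_counit : ∀ c : C, rid (map LinearMap.id counit.l (comul c)) = c

section Comodules

variable (A C : Type u) [Ring A] [AddCommGroup C] [Module A C] [Module Aᵐᵒᵖ C]
  [SMulCommClass A Aᵐᵒᵖ C] [Coring A C]

/-- A right `C`-comodule for an `A`-coring `C`: a right `A`-module with a right `A`-linear,
coassociative and counital coaction. -/
structure RightComodule where
  carrier : Type u
  [addCommGroup : AddCommGroup carrier]
  [module : Module Aᵐᵒᵖ carrier]
  coact : carrier →ₗ[Aᵐᵒᵖ] carrier ⊗ᴮ[A] C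
  coassoc : ∀ m, assoc (map coact LinearMap.id (coact m)) =
    map LinearMap.id (Coring.comul (A := A) (C := C)).l (coact m)
  coact_counit : ∀ m, rid (map LinearMap.id (Coring.counit (A := A) (C := C)).l (coact m)) = m

namespace RightComodule

instance : CoeSort (RightComodule A C) (Type u) := ⟨carrier⟩

attribute [instance] addCommGroup module

variable {A C}

/-- `Hom^C(M, N)`: the right `A`-linear and right `C`-colinear maps from `M` to `N`. -/
def homC (M N : RightComodule A C) : AddSubgroup (M →ₗ[Aᵐᵒᵖ] N) where
  carrier := {f | ∀ m, N.coact (f m) = map f LinearMap.id (M.coact m)}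
  zero_mem' m := by
    rw [← mapLeftHom_apply, map_zero, LinearMap.zero_apply, map_zero]
  add_mem' {f g} hf hg m := by
    rw [← mapLeftHom_apply, map_add, LinearMap.add_apply, map_add, hf m, hg m]; rfl
  neg_mem' {f} hf m := by
    rw [← mapLeftHom_apply, map_neg, LinearMap.neg_apply, map_neg, hf m]; rfl

theorem mem_homC {M N : RightComodule A C} {f : M →ₗ[Aᵐᵒᵖ] N} :
    f ∈ homC M N ↔ ∀ m, N.coact (f m) = map f LinearMap.id (M.coact m) := Iff.rfl

theorem id_mem (M : RightComodule A C) : LinearMap.id ∈ homC M M := fun m => by simp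

theorem comp_mem {M N P : RightComodule A C} {g : N →ₗ[Aᵐᵒᵖ] P} {f : M →ₗ[Aᵐᵒᵖ] N}
    (hg : g ∈ homC N P) (hf : f ∈ homC M N) : g ∘ₗ f ∈ homC M P := fun m => by
  rw [LinearMap.comp_apply, hg, hf, map_map]; rfl

/-- The category of right `C`-comodules. -/
instance : Category (RightComodule A C) where
  Hom M N := homC M N
  id M := ⟨LinearMap.id, id_mem M⟩
  comp f g := ⟨g.1 ∘ₗ f.1, comp_mem g.2 f.2⟩

/-- The algebra `End^C(M)` of comodule endomorphisms, multiplied by composition. -/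
def endC (M : RightComodule A C) : Subring (Module.End Aᵐᵒᵖ M) where
  carrier := {f | f ∈ homC M M}
  zero_mem' := (homC M M).zero_mem
  one_mem' := id_mem M
  add_mem' := (homC M M).add_mem
  neg_mem' := (homC M M).neg_mem
  mul_mem' := comp_mem

instance (M : RightComodule A C) : Module M.endC M :=
  Module.compHom M M.endC.subtype

@[simp] theorem endC_smul (M : RightComodule A C) (t : M.endC) (x : M) : t • x = t.1 x := rfl

instance (M : RightComodule A C) : SMulCommClass M.endC Aᵐᵒᵖ M where
  smul_comm t a x := map_smul t.1 a x

end RightComodule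

open RightComodule

variable {A C}

/-! ## The functors `- ⊗_T Σ` and `Hom^C(Σ, -)`, where `T = End^C(Σ)` -/

/-- The coaction of a comodule is linear over its comodule endomorphisms. -/
def coactEnd (X : RightComodule A C) : X →ₗ[X.endC] X ⊗ᴮ[A] C where
  toFun := X.coact
  map_add' := map_add _
  map_smul' t x := by
    rw [endC_smul, t.2 x, RingHom.id_apply]
    generalize X.coact x = z
    induction z using BTensor.induction_on with
    | tm m n => rfl
    | plus x y hx hy => rw [map_add, smul_add, hx, hy]

@[simp] theorem coactEnd_apply (X : RightComodule A C) (x : X) : coactEnd X x = X.coact x := rfl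

/-- The map `x ↦ n ⊗ x`. -/
def tmulHom (X : RightComodule A C) (N : ModuleCat.{u} X.endCᵐᵒᵖ) (n : N) :
    X →ₗ[Aᵐᵒᵖ] N ⊗ᴮ[X.endC] X where
  toFun x := tmul X.endC n x
  map_add' := tmul_add n
  map_smul' _ _ := rfl

theorem ind_aux (X : RightComodule A C) (N : ModuleCat.{u} X.endCᵐᵒᵖ) (n : N)
    (w : X ⊗ᴮ[A] C) : assoc.symm (tmul X.endC n w) = map (tmulHom X N n) LinearMap.id w := by
  induction w using BTensor.induction_on with
  | tm y c => rfl
  | plus x y hx hy => rw [tmul_add, map_add, hx, hy, map_add]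

theorem ind_aux_smul (X : RightComodule A C) (N : ModuleCat.{u} X.endCᵐᵒᵖ) (a : Aᵐᵒᵖ)
    (z : N ⊗ᴮ[X.endC] X) :
    (assoc.symm (map LinearMap.id (coactEnd X) (a • z)) : (N ⊗ᴮ[X.endC] X) ⊗ᴮ[A] C) =
      a • assoc.symm (map LinearMap.id (coactEnd X) z) := by
  induction z using BTensor.induction_on with
  | tm n x =>
    rw [right_smul_tmul, map_tmul, map_tmul, coactEnd_apply, coactEnd_apply, map_smul, ind_aux,
      ind_aux]
    exact map_smul (mapR (tmulHom X N n) LinearMap.id (fun _ _ => rfl)) a _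
  | plus x y hx hy => rw [smul_add, map_add, map_add, map_add, map_add, smul_add, hx, hy]

/-- The coaction `n ⊗ x ↦ (n ⊗ x⁰) ⊗ x¹` of `N ⊗_T X`. -/
def indCoact (X : RightComodule A C) (N : ModuleCat.{u} X.endCᵐᵒᵖ) :
    N ⊗ᴮ[X.endC] X →ₗ[Aᵐᵒᵖ] (N ⊗ᴮ[X.endC] X) ⊗ᴮ[A] C where
  toFun z := assoc.symm (map LinearMap.id (coactEnd X) z)
  map_add' a b := by rw [map_add, map_add]
  map_smul' a z := ind_aux_smul X N a z

theorem indCoact_tmul (X : RightComodule A C) (N : ModuleCat.{u} X.endCᵐᵒᵖ) (n : N) (x : X) :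
    indCoact X N (tmul X.endC n x) = map (tmulHom X N n) LinearMap.id (X.coact x) :=
  ind_aux X N n (X.coact x)

theorem indCoact_map (X : RightComodule A C) {N N' : ModuleCat.{u} X.endCᵐᵒᵖ} (f : N ⟶ N')
    (z : N ⊗ᴮ[X.endC] X) :
    indCoact X N' (map f.hom LinearMap.id z) =
      map (mapR f.hom (LinearMap.id : X →ₗ[X.endC] X) (S := A) (fun _ _ => rfl)) LinearMap.id
        (indCoact X N z) := by
  induction z using BTensor.induction_on with
  | tm n x =>
    rw [map_tmul, indCoact_tmul, indCoact_tmul, map_map]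
    rfl
  | plus x y hx hy => simp only [map_add, hx, hy]

/-- The right `C`-comodule `N ⊗_T X`. -/
def indObj (X : RightComodule A C) (N : ModuleCat.{u} X.endCᵐᵒᵖ) : RightComodule A C where
  carrier := N ⊗ᴮ[X.endC] X
  coact := indCoact X N
  coassoc z := by
    induction z using BTensor.induction_on with
    | tm n x =>
      rw [indCoact_tmul, map_map]
      have h : indCoact X N ∘ₗ tmulHom X N n =
          mapR (tmulHom X N n) (LinearMap.id : C →ₗ[A] C) (S := A) (fun _ _ => rfl) ∘ₗ
            X.coact := LinearMap.ext fun x => indCoact_tmul X N n x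
      rw [h, map_map, ← map_map _ LinearMap.id X.coact LinearMap.id, assoc_map_left, X.coassoc,
        map_map]
      rfl
    | plus x y hx hy => simp only [map_add, hx, hy]
  coact_counit z := by
    induction z using BTensor.induction_on with
    | tm n x =>
      rw [indCoact_tmul, map_map, LinearMap.id_comp, LinearMap.comp_id,
        ← LinearMap.id_comp (Coring.counit (A := A) (C := C)).l, ← LinearMap.comp_id (tmulHom X N n),
        ← map_map, rid_map, X.coact_counit]
      rfl
    | plus x y hx hy => simp only [map_add, hx, hy]

/-- The functor `- ⊗_T X` from right `T`-modules to right `C`-comodules. -/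
def indFunctor (X : RightComodule A C) : ModuleCat.{u} X.endCᵐᵒᵖ ⥤ RightComodule A C where
  obj N := indObj X N
  map f := ⟨mapR f.hom LinearMap.id (fun _ _ => rfl), indCoact_map X f⟩
  map_id N := Subtype.ext (LinearMap.ext fun z => map_id z)
  map_comp f g := Subtype.ext (LinearMap.ext fun z =>
    (map_map g.hom LinearMap.id f.hom LinearMap.id z).symm)

instance (X M : RightComodule A C) : Module X.endCᵐᵒᵖ (homC X M) where
  smul t f := ⟨f.1 ∘ₗ t.unop.1, comp_mem f.2 t.unop.2⟩
  one_smul f := rfl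
  mul_smul s t f := rfl
  smul_zero t := rfl
  smul_add t f g := rfl
  add_smul s t f := Subtype.ext (LinearMap.comp_add _ _ f.1)
  zero_smul f := Subtype.ext (LinearMap.comp_zero f.1)

/-- `Hom^C(X, M)` is a right module over `End^C(X)` by composition. -/
theorem homC_smul (X M : RightComodule A C) (t : X.endC) (f : homC X M) (x : X) :
    (op t • f).1 x = f.1 (t.1 x) := rfl

/-- The functor `Hom^C(X, -)` from right `C`-comodules to right `T`-modules. -/
def coinvFunctor (X : RightComodule A C) : RightComodule A C ⥤ ModuleCat.{u} X.endCᵐᵒᵖ where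
  obj M := ModuleCat.of X.endCᵐᵒᵖ (homC X M)
  map {M M'} f := ModuleCat.ofHom
    { toFun := fun g => ⟨f.1 ∘ₗ g.1, comp_mem f.2 g.2⟩
      map_add' := fun g h => Subtype.ext (LinearMap.comp_add _ _ f.1)
      map_smul' := fun t g => rfl }
  map_id M := rfl
  map_comp f g := rfl

end Comodules

/-! ## Right coring extensions and purity -/

section Extensions

open RightComodule

/-- The coproduct of the `A`-coring `C` is right `L`-linear for a right `L`-action on `C` that
commutes with the left `A`-action. -/
class ComulRightLinear (A C L : Type*) [Ring A] [AddCommGroup C] [Module A C] [Module Aᵐᵒᵖ C]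
    [SMulCommClass A Aᵐᵒᵖ C] [Coring A C] [Ring L] [Module Lᵐᵒᵖ C] [SMulCommClass A Lᵐᵒᵖ C] :
    Prop where
  comul_smul : ∀ (l : Lᵐᵒᵖ) (c : C),
    Coring.comul (A := A) (l • c) = l • Coring.comul (A := A) c

/-- The coproduct of `C` as a right `L`-linear map. -/
def comulR (A C L : Type*) [Ring A] [AddCommGroup C] [Module A C] [Module Aᵐᵒᵖ C]
    [SMulCommClass A Aᵐᵒᵖ C] [Coring A C] [Ring L] [Module Lᵐᵒᵖ C] [SMulCommClass A Lᵐᵒᵖ C]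
    [ComulRightLinear A C L] : C →ₗ[Lᵐᵒᵖ] C ⊗ᴮ[A] C where
  toFun := Coring.comul (A := A) (C := C)
  map_add' := map_add (Coring.comul (A := A) (C := C)).1
  map_smul' := ComulRightLinear.comul_smul

/-- The `L`-coring `D` is a right extension of the `A`-coring `C`: `C` is a `C`-`D` bicomodule
with its regular left coaction, that is, there is a left `A`-linear right `D`-coaction `tau` on `C`
such that the coproduct of `C` is right `D`-colinear. -/
class RightExtension (A C L D : Type*) [Ring A] [AddCommGroup C] [Module A C] [Module Aᵐᵒᵖ C]
    [SMulCommClass A Aᵐᵒᵖ C] [Coring A C] [Ring L] [Module Lᵐᵒᵖ C] [SMulCommClass A Lᵐᵒᵖ C]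
    [ComulRightLinear A C L] [AddCommGroup D] [Module L D] [Module Lᵐᵒᵖ D]
    [SMulCommClass L Lᵐᵒᵖ D] [Coring L D] where
  tau : BimodHom A L C (C ⊗ᴮ[L] D)
  coassoc : ∀ c : C, assoc (map tau.r LinearMap.id (tau c)) =
    map LinearMap.id (Coring.comul (A := L) (C := D)).l (tau c)
  tau_counit : ∀ c : C, rid (map LinearMap.id (Coring.counit (A := L) (C := D)).l (tau c)) = c
  comul_colinear : ∀ c : C, assoc (map (comulR A C L) LinearMap.id (tau c)) =
    map LinearMap.id tau.l (Coring.comul (A := A) c)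

variable {A C L D : Type u} [Ring A] [AddCommGroup C] [Module A C] [Module Aᵐᵒᵖ C]
  [SMulCommClass A Aᵐᵒᵖ C] [Coring A C] [Ring L] [Module Lᵐᵒᵖ C] [SMulCommClass A Lᵐᵒᵖ C]
  [ComulRightLinear A C L]

/-- The map `m ⊗ c ↦ m g(c)`. -/
def ev {M : Type*} [AddCommGroup M] [Module Aᵐᵒᵖ M] (g : C →ₗ[A] A) : M ⊗ᴮ[A] C →+ M :=
  rid.comp (map LinearMap.id g)

@[simp] theorem ev_tmul {M : Type*} [AddCommGroup M] [Module Aᵐᵒᵖ M] (g : C →ₗ[A] A) (m : M)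
    (c : C) : ev g (tmul A m c) = op (g c) • m := rfl

theorem ev_map {M M' : Type*} [AddCommGroup M] [Module Aᵐᵒᵖ M] [AddCommGroup M'] [Module Aᵐᵒᵖ M']
    (g : C →ₗ[A] A) (f : M →ₗ[Aᵐᵒᵖ] M') (w : M ⊗ᴮ[A] C) :
    f (ev g w) = ev g (map f LinearMap.id w) := by
  induction w using BTensor.induction_on with
  | tm m c => simp
  | plus x y hx hy => simp only [map_add, hx, hy]

theorem ev_assoc_symm {M : Type*} [AddCommGroup M] [Module Aᵐᵒᵖ M] (g : C →ₗ[A] A) (m : M)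
    (u : C ⊗ᴮ[A] C) : ev g (assoc.symm (tmul A m u)) = tmul A m (ev g u) := by
  induction u using BTensor.induction_on with
  | tm x y => rfl
  | plus x y hx hy => simp only [tmul_add, map_add, hx, hy]

theorem ev_coact_coact (g : C →ₗ[A] A) (M : RightComodule A C) (m : M) :
    M.coact (ev g (M.coact m)) =
      ev g (assoc.symm (map LinearMap.id (Coring.comul (A := A) (C := C)).l (M.coact m))) := by
  rw [ev_map, ← M.coassoc, AddEquiv.symm_apply_apply]

/-- The counit of `C` as a left linear map. -/
abbrev counitL (A C : Type*) [Ring A] [AddCommGroup C] [Module A C] [Module Aᵐᵒᵖ C]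
    [SMulCommClass A Aᵐᵒᵖ C] [Coring A C] : C →ₗ[A] A := (Coring.counit (A := A) (C := C)).l

theorem coact_ev_counit (M : RightComodule A C) (l : Lᵐᵒᵖ) (m : M) :
    M.coact (ev (counitL A C) (l • M.coact m)) = l • M.coact m := by
  have h1 : map M.coact LinearMap.id (l • M.coact m) =
      l • assoc.symm (map LinearMap.id (Coring.comul (A := A) (C := C)).l (M.coact m)) := by
    rw [← M.coassoc, AddEquiv.symm_apply_apply]
    exact map_smul (mapR M.coact (LinearMap.id : C →ₗ[A] C) (fun _ _ => rfl)) l (M.coact m)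
  rw [ev_map, h1]
  generalize M.coact m = w
  induction w using BTensor.induction_on with
  | tm m c =>
    have h2 : ∀ u : C ⊗ᴮ[A] C, ev (counitL A C) (l • assoc.symm (tmul A m u)) =
        tmul A m (ev (counitL A C) (l • u)) := fun u => by
      induction u using BTensor.induction_on with
      | tm x y => rfl
      | plus x y hx hy => simp only [tmul_add, map_add, smul_add, hx, hy]
    rw [map_tmul, LinearMap.id_apply, h2, right_smul_tmul, BimodHom.l_apply,
      ← ComulRightLinear.comul_smul]
    exact congrArg (tmul A m) (Coring.comul_counit (l • c))
  | plus x y hx hy => simp only [map_add, smul_add, hx, hy]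

/-- The right `L`-action `m l = m⁰ ε(m¹ l)` on a right `C`-comodule. -/
instance inducedModule (M : RightComodule A C) : Module Lᵐᵒᵖ M where
  smul l m := ev (counitL A C) (l • M.coact m)
  one_smul m := by
    change ev (counitL A C) ((1 : Lᵐᵒᵖ) • M.coact m) = m
    rw [one_smul]
    exact M.coact_counit m
  mul_smul s t m := by
    change ev (counitL A C) ((s * t) • M.coact m) =
      ev (counitL A C) (s • M.coact (ev (counitL A C) (t • M.coact m)))
    rw [coact_ev_counit, mul_smul]
  smul_zero s := by
    change ev (counitL A C) (s • M.coact 0) = 0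
    rw [map_zero, smul_zero, map_zero]
  smul_add s m m' := by
    change ev (counitL A C) (s • M.coact (m + m')) =
      ev (counitL A C) (s • M.coact m) + ev (counitL A C) (s • M.coact m')
    rw [map_add, smul_add, map_add]
  add_smul s t m := by
    change ev (counitL A C) ((s + t) • M.coact m) =
      ev (counitL A C) (s • M.coact m) + ev (counitL A C) (t • M.coact m)
    rw [add_smul, map_add]
  zero_smul m := by
    change ev (counitL A C) ((0 : Lᵐᵒᵖ) • M.coact m) = 0
    rw [zero_smul, map_zero]

theorem induced_smul (M : RightComodule A C) (l : Lᵐᵒᵖ) (m : M) :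
    l • m = ev (counitL A C) (l • M.coact m) := rfl

variable (L) in
/-- The coaction `M → M ⊗ C` as a right `L`-linear map. -/
def coactL (M : RightComodule A C) : M →ₗ[Lᵐᵒᵖ] M ⊗ᴮ[A] C where
  toFun := M.coact
  map_add' := map_add _
  map_smul' l m := coact_ev_counit M l m

variable (L) in
/-- The map `m ⊗ c ↦ m⁰ ⊗ (m¹ ⊗ c)` as a right `L`-linear map. -/
def coactTensor (M : RightComodule A C) : M ⊗ᴮ[A] C →ₗ[Lᵐᵒᵖ] M ⊗ᴮ[A] (C ⊗ᴮ[A] C) where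
  toFun z := assoc (map M.coact LinearMap.id z)
  map_add' x y := by rw [map_add, map_add]
  map_smul' l z := by
    induction z using BTensor.induction_on with
    | tm m c =>
      rw [right_smul_tmul, map_tmul, map_tmul, RingHom.id_apply]
      generalize M.coact m = w
      induction w using BTensor.induction_on with
      | tm y c => rfl
      | plus x y hx hy =>
        simp only [LinearMap.id_apply, add_tmul, map_add, smul_add] at hx hy ⊢
        rw [hx, hy]
    | plus x y hx hy => simp only [map_add, smul_add, hx, hy]

variable (L) in
/-- The map `m ⊗ c ↦ m ⊗ (c₁ ⊗ c₂)` as a right `L`-linear map. -/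
def tensorComul (M : RightComodule A C) : M ⊗ᴮ[A] C →ₗ[Lᵐᵒᵖ] M ⊗ᴮ[A] (C ⊗ᴮ[A] C) :=
  mapR LinearMap.id (Coring.comul (A := A) (C := C)).l ComulRightLinear.comul_smul

/-- The functor `- ⊗_L X` preserves the equaliser `M → M ⊗ C ⇉ M ⊗ C ⊗ C`: the map `ϱ ⊗ X` is
injective, with image the equaliser of `ϱ ⊗ C ⊗ X` and `M ⊗ Δ ⊗ X`. -/
def PreservesCoactEqualiser (M : RightComodule A C) (X : Type u) [AddCommGroup X] [Module L X] :
    Prop :=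
  Function.Injective (map (coactL L M) (LinearMap.id : X →ₗ[L] X)) ∧
  ∀ z : (M ⊗ᴮ[A] C) ⊗ᴮ[L] X,
    map (coactTensor L M) LinearMap.id z = map (tensorComul L M) LinearMap.id z →
      ∃ y, map (coactL L M) LinearMap.id y = z

variable [AddCommGroup D] [Module L D] [Module Lᵐᵒᵖ D] [SMulCommClass L Lᵐᵒᵖ D] [Coring L D]

variable (A C L D) in
/-- The right coring extension `D` of `C` is pure: the defining equaliser of every right
`C`-comodule is preserved by `- ⊗_L D ⊗_L D`. -/
def IsPure : Prop := ∀ M : RightComodule A C, PreservesCoactEqualiser (L := L) M (D ⊗ᴮ[L] D)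

/-- The map `d ⊗ d' ↦ ε(d) d'`. -/
def counitTensor (L D : Type*) [Ring L] [AddCommGroup D] [Module L D] [Module Lᵐᵒᵖ D]
    [SMulCommClass L Lᵐᵒᵖ D] [Coring L D] : D ⊗ᴮ[L] D →ₗ[L] D where
  toFun z := lid (map (Coring.counit (A := L) (C := D)).r LinearMap.id z)
  map_add' x y := by rw [map_add, map_add]
  map_smul' l z := by
    induction z using BTensor.induction_on with
    | tm d d' =>
      rw [left_smul_tmul, map_tmul, map_tmul, BimodHom.r_apply,
        (Coring.counit (A := L) (C := D)).2.1]
      exact mul_smul _ _ _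
    | plus x y hx hy => simp only [map_add, smul_add, hx, hy]

theorem IsPure.preserves (h : IsPure A C L D) (M : RightComodule A C) :
    PreservesCoactEqualiser (L := L) M D := by
  have hc : counitTensor L D ∘ₗ (Coring.comul (A := L) (C := D)).l = LinearMap.id :=
    LinearMap.ext fun d => Coring.counit_comul (A := L) d
  have swap : ∀ {X Y : Type u} [AddCommGroup X] [Module Lᵐᵒᵖ X] [AddCommGroup Y] [Module Lᵐᵒᵖ Y]
      {V W : Type u} [AddCommGroup V] [Module L V] [AddCommGroup W] [Module L W]
      (f : X →ₗ[Lᵐᵒᵖ] Y) (g : V →ₗ[L] W) (z : X ⊗ᴮ[L] V),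
      map LinearMap.id g (map f LinearMap.id z) = map f LinearMap.id (map LinearMap.id g z) := by
    intros
    rw [map_map, map_map]
    rfl
  have ret : ∀ {X : Type u} [AddCommGroup X] [Module Lᵐᵒᵖ X] (z : X ⊗ᴮ[L] D),
      map LinearMap.id (counitTensor L D)
        (map LinearMap.id (Coring.comul (A := L) (C := D)).l z) = z := by
    intro X _ _ z
    rw [map_map, hc, LinearMap.id_comp, map_id]
  obtain ⟨h1, h2⟩ := h M
  constructor
  · intro y y' hy
    have h3 := congrArg (map LinearMap.id (Coring.comul (A := L) (C := D)).l) hy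
    rw [swap, swap] at h3
    rw [← ret y, h1 h3, ret y']
  · intro z hz
    obtain ⟨y, hy⟩ := h2 (map LinearMap.id (Coring.comul (A := L) (C := D)).l z) (by
      rw [← swap, hz, swap])
    exact ⟨map LinearMap.id (counitTensor L D) y, by rw [← swap, hy, ret]⟩

/-- The associator `(M ⊗ C) ⊗ C → M ⊗ (C ⊗ C)` as a right `L`-linear map. -/
def assocR (L : Type u) [Ring L] [Module Lᵐᵒᵖ C] [SMulCommClass A Lᵐᵒᵖ C] (M : RightComodule A C) :
    (M ⊗ᴮ[A] C) ⊗ᴮ[A] C →ₗ[Lᵐᵒᵖ] M ⊗ᴮ[A] (C ⊗ᴮ[A] C) where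
  toFun z := assoc z
  map_add' := map_add _
  map_smul' l z := by
    induction z using BTensor.induction_on with
    | tm w c =>
      induction w using BTensor.induction_on with
      | tm m c' => rfl
      | plus x y hx hy => simp only [add_tmul, map_add, smul_add, hx, hy]
    | plus x y hx hy => simp only [map_add, smul_add, hx, hy]

/-- The map `u ↦ m ⊗ u` as a right `L`-linear map. -/
def tmulR (L : Type u) [Ring L] [Module Lᵐᵒᵖ C] [SMulCommClass A Lᵐᵒᵖ C] (M : RightComodule A C)
    (m : M) : C ⊗ᴮ[A] C →ₗ[Lᵐᵒᵖ] M ⊗ᴮ[A] (C ⊗ᴮ[A] C) where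
  toFun u := tmul A m u
  map_add' := tmul_add m
  map_smul' _ _ := rfl

variable [RightExtension A C L D]

variable (A C L D) in
/-- The right `D`-coaction of `C` as a left `A`-linear map. -/
abbrev tauL : C →ₗ[A] C ⊗ᴮ[L] D := (RightExtension.tau (A := A) (C := C) (L := L) (D := D)).l

theorem tau_mem_equaliser (M : RightComodule A C) (m : M) :
    map (coactTensor L M) LinearMap.id
      (assoc.symm (map LinearMap.id (tauL A C L D) (M.coact m))) =
    map (tensorComul L M) LinearMap.id
      (assoc.symm (map LinearMap.id (tauL A C L D) (M.coact m))) := by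
  have h1 : ∀ t : M ⊗ᴮ[A] C, map (coactTensor L M) LinearMap.id
      (assoc.symm (map LinearMap.id (tauL A C L D) t)) =
      map (assocR L M) LinearMap.id (assoc.symm
        (map LinearMap.id (tauL A C L D) (map M.coact LinearMap.id t))) := fun t => by
    induction t using BTensor.induction_on with
    | tm m c =>
      simp only [map_tmul, LinearMap.id_apply]
      generalize tauL A C L D c = v
      induction v using BTensor.induction_on with
      | tm c' d =>
        simp only [assoc_symm_tmul, map_tmul, LinearMap.id_apply]
        rfl
      | plus x y hx hy => simp only [tmul_add, map_add, hx, hy]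
    | plus x y hx hy => simp only [map_add, hx, hy]
  have h2 : ∀ (m : M) (u : C ⊗ᴮ[A] C), map (assocR L M) LinearMap.id (assoc.symm
      (map LinearMap.id (tauL A C L D) (assoc.symm (tmul A m u)))) =
      map (tmulR L M m) LinearMap.id (assoc.symm (map LinearMap.id (tauL A C L D) u)) :=
    fun m u => by
    induction u using BTensor.induction_on with
    | tm c c' =>
      simp only [map_tmul, LinearMap.id_apply, assoc_symm_tmul]
      generalize tauL A C L D c' = v
      induction v using BTensor.induction_on with
      | tm c'' d => rfl
      | plus x y hx hy => simp only [tmul_add, map_add, hx, hy]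
    | plus x y hx hy => simp only [tmul_add, map_add, hx, hy]
  have h3 : map M.coact LinearMap.id (M.coact m) =
      assoc.symm (map LinearMap.id (Coring.comul (A := A) (C := C)).l (M.coact m)) := by
    rw [← M.coassoc, AddEquiv.symm_apply_apply]
  rw [h1, h3]
  generalize M.coact m = w
  induction w using BTensor.induction_on with
  | tm m c =>
    rw [map_tmul, LinearMap.id_apply, h2, map_tmul, LinearMap.id_apply, BimodHom.l_apply]
    rw [← RightExtension.comul_colinear (A := A) (L := L) (D := D) c, AddEquiv.symm_apply_apply,
      BimodHom.l_apply]
    generalize (RightExtension.tau (A := A) (L := L) (D := D)) c = v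
    induction v using BTensor.induction_on with
    | tm c d => rfl
    | plus x y hx hy => simp only [tmul_add, map_add, hx, hy]
  | plus x y hx hy => simp only [map_add, hx, hy]

theorem exists_coactD (h : IsPure A C L D) (M : RightComodule A C) (m : M) :
    ∃ y : M ⊗ᴮ[L] D, map (coactL L M) LinearMap.id y =
      assoc.symm (map LinearMap.id (tauL A C L D) (M.coact m)) :=
  (h.preserves M).2 _ (tau_mem_equaliser M m)

/-- The right `D`-coaction of a right `C`-comodule `M`, obtained from `M ≅ M □_C C`: it is the
unique map `M → M ⊗_L D` whose composite with the injective map `ϱ ⊗ D` is `(M ⊗ τ) ϱ`. -/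
def coactD (h : IsPure A C L D) (M : RightComodule A C) : M →+ M ⊗ᴮ[L] D :=
  AddMonoidHom.mk' (fun m => (exists_coactD h M m).choose) (fun m m' => by
    apply (h.preserves M).1
    refine (exists_coactD h M (m + m')).choose_spec.trans ?_
    rw [map_add, map_add, map_add, map_add, (exists_coactD h M m).choose_spec,
      (exists_coactD h M m').choose_spec])

theorem coactD_spec (h : IsPure A C L D) (M : RightComodule A C) (m : M) :
    map (coactL L M) LinearMap.id (coactD h M m) =
      assoc.symm (map LinearMap.id (tauL A C L D) (M.coact m)) :=
  (exists_coactD h M m).choose_spec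

/-! ## The Morita context of a bicomodule -/

/-- A right `C`-comodule `X` with a left `L`-action is an `L`-`C` bicomodule: the coaction is left
`L`-linear. -/
class Bicomodule (L : Type u) [Ring L] (X : RightComodule A C) [Module L X]
    [SMulCommClass L Aᵐᵒᵖ X] : Prop where
  coact_smul : ∀ (l : L) (x : X), X.coact (l • x) = l • X.coact x

variable (X : RightComodule A C) [Module L X] [SMulCommClass L Aᵐᵒᵖ X] [Bicomodule L X]

variable (L) in
/-- The unit map `L → T`, `l ↦ (x ↦ l x)`, of the `L`-ring `T = End^C(X)`. -/
def unitMap : L →+* X.endC where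
  toFun l := ⟨smulHom Aᵐᵒᵖ l, fun x => Bicomodule.coact_smul l x⟩
  map_one' := Subtype.ext (LinearMap.ext fun x => one_smul L x)
  map_mul' l l' := Subtype.ext (LinearMap.ext fun x => mul_smul l l' x)
  map_zero' := Subtype.ext (LinearMap.ext fun x => zero_smul L x)
  map_add' l l' := Subtype.ext (LinearMap.ext fun x => add_smul l l' x)

/-- The left `L`-action on `T`. -/
instance endLeft : Module L X.endC := Module.compHom X.endC (unitMap L X)

/-- The right `L`-action on `T`. -/
instance endRight : Module Lᵐᵒᵖ X.endC := Module.compHom X.endC (unitMap L X).op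

theorem end_smul (l : L) (t : X.endC) : l • t = unitMap L X l * t := rfl

theorem end_op_smul (l : L) (t : X.endC) : op l • t = t * unitMap L X l := rfl

/-- The dual `X* = Hom_A(X, A)`, a left `A`-module by `(a ξ)(x) = a ξ(x)`. -/
abbrev dual (X : RightComodule A C) : Type u := X →ₗ[Aᵐᵒᵖ] A

/-- The right `L`-action `(ξ l)(x) = ξ(l x)` on the dual. -/
instance dualRight : Module Lᵐᵒᵖ (dual X) where
  smul l ξ := ξ ∘ₗ smulHom Aᵐᵒᵖ l.unop
  one_smul ξ := LinearMap.ext fun x => congrArg ξ (one_smul L x)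
  mul_smul l l' ξ := LinearMap.ext fun x => congrArg ξ (mul_smul l'.unop l.unop x)
  smul_zero l := rfl
  smul_add l ξ ξ' := rfl
  add_smul l l' ξ := LinearMap.ext fun x =>
    (congrArg ξ (add_smul l.unop l'.unop x)).trans (map_add ξ _ _)
  zero_smul ξ := LinearMap.ext fun x => (congrArg ξ (zero_smul L x)).trans (map_zero ξ)

theorem dual_smul (l : L) (ξ : dual X) (x : X) : (op l • ξ) x = ξ (l • x) := rfl

/-- The map `x ⊗ n ↦ ξ(x) n`. -/
def evDual {X : RightComodule A C} {N : Type*} [AddCommGroup N] [Module A N] (ξ : dual X) :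
    X ⊗ᴮ[A] N →+ N :=
  lid.comp (map ξ LinearMap.id)

/-- `ev` as an additive function of the functional. -/
def evHom {M : Type*} [AddCommGroup M] [Module Aᵐᵒᵖ M] (w : M ⊗ᴮ[A] C) : (C →ₗ[A] A) →+ M :=
  rid.comp (mapRightHom LinearMap.id w)

/-- `evDual` as an additive function of the functional. -/
def evDualHom {X : RightComodule A C} {N : Type*} [AddCommGroup N] [Module A N]
    (w : X ⊗ᴮ[A] N) : dual X →+ N :=
  lid.comp (mapLeftHom LinearMap.id w)

/-- For `q : C → X*` and `x ∈ X`, the map `c ↦ q(c)(x)`. -/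
def atPoint {X : RightComodule A C} (q : C →ₗ[A] dual X) (x : X) : C →ₗ[A] A where
  toFun c := q c x
  map_add' c c' := by rw [map_add]; rfl
  map_smul' a c := by rw [map_smul]; rfl

/-- `q ↦ q(-)(x)` as an additive map. -/
def atPointHom (L : Type u) [Ring L] [Module Lᵐᵒᵖ C] {X : RightComodule A C} [Module L X]
    [SMulCommClass L Aᵐᵒᵖ X] (x : X) : BimodHom A L C (dual X) →+ (C →ₗ[A] A) :=
  AddMonoidHom.mk' (fun q => atPoint q.l x) (fun _ _ => rfl)

/-- The group `Q̃` of the `A`-`L` bimodule maps `q : C → X*` such that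
`c₁ q(c₂)(x) = q(c)(x⁰) x¹` for all `x` and `c`. -/
def QTilde (L : Type u) [Ring L] [Module Lᵐᵒᵖ C] (X : RightComodule A C) [Module L X]
    [SMulCommClass L Aᵐᵒᵖ X] : AddSubgroup (BimodHom A L C (dual X)) where
  carrier := {q | ∀ (x : X) (c : C),
    ev (atPoint q.l x) (Coring.comul (A := A) c) = evDual (q c) (X.coact x)}
  zero_mem' x c := (map_zero ((evHom (Coring.comul (A := A) c)).comp (atPointHom L x))).trans
    (map_zero (evDualHom (X.coact x))).symm
  add_mem' {q q'} hq hq' x c :=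
    (map_add ((evHom (Coring.comul (A := A) c)).comp (atPointHom L x)) q q').trans
      ((congrArg₂ (· + ·) (hq x c) (hq' x c)).trans
        (map_add (evDualHom (X.coact x)) (q c) (q' c)).symm)
  neg_mem' {q} hq x c :=
    (map_neg ((evHom (Coring.comul (A := A) c)).comp (atPointHom L x)) q).trans
      ((congrArg Neg.neg (hq x c)).trans (map_neg (evDualHom (X.coact x)) (q c)).symm)

/-- The group `_L Hom^D(D, X)` of left `L`-linear and right `D`-colinear maps. -/
def homD (h : IsPure A C L D) (X : RightComodule A C) [Module L X] :
    AddSubgroup (BimodHom L L D X) where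
  carrier := {p | ∀ d, coactD h X (p d) =
    map p.r LinearMap.id (Coring.comul (A := L) (C := D) d)}
  zero_mem' d := (map_zero (coactD h X)).trans (map_zero ((mapLeftHom LinearMap.id
    (Coring.comul (A := L) (C := D) d)).comp BimodHom.rHom)).symm
  add_mem' {p p'} hp hp' d := (map_add (coactD h X) (p d) (p' d)).trans
    ((congrArg₂ (· + ·) (hp d) (hp' d)).trans (map_add ((mapLeftHom LinearMap.id
      (Coring.comul (A := L) (C := D) d)).comp BimodHom.rHom) p p').symm)
  neg_mem' {p} hp d := (map_neg (coactD h X) (p d)).trans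
    ((congrArg Neg.neg (hp d)).trans (map_neg ((mapLeftHom LinearMap.id
      (Coring.comul (A := L) (C := D) d)).comp BimodHom.rHom) p).symm)

variable (A C L D) in
/-- The group `^C End^D(C)` of left `C`-colinear and right `D`-colinear endomorphisms of `C`. -/
def endCD : AddSubgroup (BimodHom A L C C) where
  carrier := {u | (∀ c, Coring.comul (A := A) (u c) =
      map LinearMap.id u.l (Coring.comul (A := A) c)) ∧
    ∀ c, tauL A C L D (u c) = map u.r LinearMap.id (tauL A C L D c)}
  zero_mem' := ⟨fun c => (map_zero (Coring.comul (A := A) (C := C)).1).trans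
      (map_zero ((mapRightHom LinearMap.id (Coring.comul (A := A) c)).comp BimodHom.lHom)).symm,
    fun c => (map_zero (tauL A C L D)).trans
      (map_zero ((mapLeftHom LinearMap.id (tauL A C L D c)).comp BimodHom.rHom)).symm⟩
  add_mem' {u u'} hu hu' := ⟨fun c => (map_add (Coring.comul (A := A) (C := C)).1 (u c) (u' c)).trans
      ((congrArg₂ (· + ·) (hu.1 c) (hu'.1 c)).trans (map_add ((mapRightHom LinearMap.id
        (Coring.comul (A := A) c)).comp BimodHom.lHom) u u').symm),
    fun c => (map_add (tauL A C L D) (u c) (u' c)).trans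
      ((congrArg₂ (· + ·) (hu.2 c) (hu'.2 c)).trans (map_add ((mapLeftHom LinearMap.id
        (tauL A C L D c)).comp BimodHom.rHom) u u').symm)⟩
  neg_mem' {u} hu := ⟨fun c => (map_neg (Coring.comul (A := A) (C := C)).1 (u c)).trans
      ((congrArg Neg.neg (hu.1 c)).trans (map_neg ((mapRightHom LinearMap.id
        (Coring.comul (A := A) c)).comp BimodHom.lHom) u).symm),
    fun c => (map_neg (tauL A C L D) (u c)).trans
      ((congrArg Neg.neg (hu.2 c)).trans (map_neg ((mapLeftHom LinearMap.id
        (tauL A C L D c)).comp BimodHom.rHom) u).symm)⟩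

/-- The right `A`-linear map `x ↦ m q(c)(x)`, summed over `w = m ⊗ c`. -/
def actLinAux {X : RightComodule A C} {M : Type*} [AddCommGroup M] [Module Aᵐᵒᵖ M]
    (q : C →ₗ[A] dual X) (w : M ⊗ᴮ[A] C) : X →ₗ[Aᵐᵒᵖ] M where
  toFun x := ev (atPoint q x) w
  map_add' x y := by
    induction w using BTensor.induction_on with
    | tm m c =>
      change op (q c (x + y)) • m = op (q c x) • m + op (q c y) • m
      rw [map_add, MulOpposite.op_add, add_smul]
    | plus v w hv hw => rw [map_add, map_add, map_add, hv, hw]; abel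
  map_smul' a x := by
    induction w using BTensor.induction_on with
    | tm m c =>
      change op (q c (a • x)) • m = a • op (q c x) • m
      rw [map_smul, ← mul_smul]
      rfl
    | plus v w hv hw => rw [map_add, map_add, hv, hw, RingHom.id_apply, smul_add]

/-- `actLinAux` as an additive map. -/
def actLin {X : RightComodule A C} {M : Type*} [AddCommGroup M] [Module Aᵐᵒᵖ M]
    (q : C →ₗ[A] dual X) : M ⊗ᴮ[A] C →+ (X →ₗ[Aᵐᵒᵖ] M) :=
  AddMonoidHom.mk' (actLinAux q)
    (fun v w => LinearMap.ext fun x => map_add (ev (atPoint q x)) v w)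

@[simp] theorem actLin_apply {X : RightComodule A C} {M : Type*} [AddCommGroup M] [Module Aᵐᵒᵖ M]
    (q : C →ₗ[A] dual X) (w : M ⊗ᴮ[A] C) (x : X) : actLin q w x = ev (atPoint q x) w := rfl

theorem actLin_mem (q : QTilde L X) (M : RightComodule A C) (m : M) :
    actLin q.1.l (M.coact m) ∈ homC X M := fun x => by
  rw [actLin_apply, ev_coact_coact]
  generalize M.coact m = w
  induction w using BTensor.induction_on with
  | tm m c =>
    rw [map_tmul, LinearMap.id_apply, ev_assoc_symm, BimodHom.l_apply, q.2 x c]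
    generalize X.coact x = v
    induction v using BTensor.induction_on with
    | tm y c' => exact (smul_tmul (q.1 c y) m c').symm
    | plus v w hv hw => rw [map_add, map_add, tmul_add, hv, hw]
  | plus v w hv hw =>
    rw [map_add, map_add, map_add, map_add, hv, hw]
    exact (map_add_left _ _ LinearMap.id (X.coact x)).symm

/-- The map `m ↦ m q(-)` from `M` to `Hom^C(X, M)`, where `(m q(-))(x) = m⁰ q(m¹)(x)`. -/
def actQ (q : QTilde L X) (M : RightComodule A C) : M →+ homC X M :=
  AddMonoidHom.mk' (fun m => ⟨actLin q.1.l (M.coact m), actLin_mem X q M m⟩)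
    (fun m m' => Subtype.ext (map_add ((actLin q.1.l).comp M.coact.toAddMonoidHom) m m'))

theorem actQ_apply (q : QTilde L X) (M : RightComodule A C) (m : M) (x : X) :
    (actQ X q M m).1 x = ev (atPoint q.1.l x) (M.coact m) := rfl

/-- The second connecting map: `(p ◇ q)(d) = p(d)⁰ q(p(d)¹)(-)`. -/
def diamond {h : IsPure A C L D} (p : homD h X) (q : QTilde L X) : BimodHom L L D X.endC :=
  ⟨AddMonoidHom.mk' (fun d => ⟨(actQ X q X (p.1 d)).1, (actQ X q X (p.1 d)).2⟩)
    (fun d d' => Subtype.ext (congrArg Subtype.val (map_add ((actQ X q X).comp p.1.1) d d'))), by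
    constructor
    · intro l d
      refine Subtype.ext (LinearMap.ext fun x => ?_)
      change ev (atPoint q.1.l x) (X.coact (p.1 (l • d))) =
        l • ev (atPoint q.1.l x) (X.coact (p.1 d))
      rw [p.1.2.1, Bicomodule.coact_smul]
      generalize X.coact (p.1 d) = w
      induction w using BTensor.induction_on with
      | tm y c => exact (smul_comm l _ y).symm
      | plus v w hv hw => rw [smul_add, map_add, map_add, smul_add, hv, hw]
    · intro l d
      refine Subtype.ext (LinearMap.ext fun x => ?_)
      change ev (atPoint q.1.l x) (X.coact (p.1 (op l • d))) =
        ev (atPoint q.1.l (l • x)) (X.coact (p.1 d))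
      have h1 : X.coact (op l • p.1 d) = op l • X.coact (p.1 d) :=
        (coactL L X).map_smul (op l) (p.1 d)
      rw [p.1.2.2, h1]
      generalize X.coact (p.1 d) = w
      induction w using BTensor.induction_on with
      | tm y c => exact congrArg (fun ξ : dual X => op (ξ x) • y) (q.1.2.2 l c)
      | plus v w hv hw => rw [smul_add, map_add, map_add, hv, hw]⟩

theorem evDual_map {N N' : Type*} [AddCommGroup N] [Module A N] [AddCommGroup N'] [Module A N']
    (ξ : dual X) (g : N →ₗ[A] N') (w : X ⊗ᴮ[A] N) :
    g (evDual ξ w) = evDual ξ (map LinearMap.id g w) := by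
  induction w using BTensor.induction_on with
  | tm x n => exact map_smul g (ξ x) n
  | plus v w hv hw => simp only [map_add, hv, hw]

theorem evDual_smul {N : Type*} [AddCommGroup N] [Module A N] (a : A) (ξ : dual X)
    (w : X ⊗ᴮ[A] N) : evDual (a • ξ) w = a • evDual ξ w := by
  induction w using BTensor.induction_on with
  | tm x n => exact mul_smul a (ξ x) n
  | plus v w hv hw => simp only [map_add, smul_add, hv, hw]

/-- The additive map `c ⊗ d ↦ q(c)(p(d)⁰) p(d)¹`. -/
def blackAdd {h : IsPure A C L D} (q : QTilde L X) (p : homD h X) : C ⊗ᴮ[L] D →+ C :=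
  BTensor.lift (fun c d => evDual (q.1 c) (X.coact (p.1 d)))
      (fun c c' d => by
        rw [map_add]
        exact map_add (evDualHom (X.coact (p.1 d))) (q.1 c) (q.1 c'))
      (fun c d d' => by rw [map_add, map_add, map_add])
      (fun l c d => by
        rw [q.1.2.2, p.1.2.1, Bicomodule.coact_smul]
        generalize X.coact (p.1 d) = w
        induction w using BTensor.induction_on with
        | tm x n => rfl
        | plus v w hv hw => rw [smul_add, map_add, map_add, hv, hw])

theorem blackAdd_tmul {h : IsPure A C L D} (q : QTilde L X) (p : homD h X) (c : C) (d : D) :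
    blackAdd X q p (tmul L c d) = evDual (q.1 c) (X.coact (p.1 d)) := rfl

theorem blackAdd_left {h : IsPure A C L D} (q : QTilde L X) (p : homD h X) (a : A)
    (z : C ⊗ᴮ[L] D) : blackAdd X q p (a • z) = a • blackAdd X q p z := by
  induction z using BTensor.induction_on with
  | tm c d => rw [left_smul_tmul, blackAdd_tmul, blackAdd_tmul, q.1.2.1, evDual_smul]
  | plus v w hv hw => rw [smul_add, map_add, map_add, smul_add, hv, hw]

theorem blackAdd_right {h : IsPure A C L D} (q : QTilde L X) (p : homD h X) (l : L)
    (z : C ⊗ᴮ[L] D) : blackAdd X q p (op l • z) = op l • blackAdd X q p z := by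
  induction z using BTensor.induction_on with
  | tm c d =>
    have h1 : X.coact (op l • p.1 d) = op l • X.coact (p.1 d) :=
      (coactL L X).map_smul (op l) (p.1 d)
    rw [right_smul_tmul, blackAdd_tmul, blackAdd_tmul, p.1.2.2, h1]
    generalize X.coact (p.1 d) = w
    induction w using BTensor.induction_on with
    | tm x n => exact smul_comm (q.1 c x) (op l) n
    | plus v w hv hw => rw [smul_add, map_add, map_add, smul_add, hv, hw]
  | plus v w hv hw => rw [smul_add, map_add, map_add, smul_add, hv, hw]

/-- The bimodule map `c ⊗ d ↦ q(c)(p(d)⁰) p(d)¹`. -/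
def blackAux {h : IsPure A C L D} (q : QTilde L X) (p : homD h X) :
    BimodHom A L (C ⊗ᴮ[L] D) C :=
  ⟨blackAdd X q p, blackAdd_left X q p, blackAdd_right X q p⟩

theorem blackAux_tmul {h : IsPure A C L D} (q : QTilde L X) (p : homD h X) (c : C) (d : D) :
    blackAux X q p (tmul L c d) = evDual (q.1 c) (X.coact (p.1 d)) := rfl

theorem comul_blackAux {h : IsPure A C L D} (q : QTilde L X) (p : homD h X) (z : C ⊗ᴮ[L] D) :
    Coring.comul (A := A) (blackAux X q p z) =
      map LinearMap.id (blackAux X q p).l (assoc (map (comulR A C L) LinearMap.id z)) := by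
  induction z using BTensor.induction_on with
  | tm c d =>
    have h1 : ∀ w : C ⊗ᴮ[A] C, map LinearMap.id (blackAux X q p).l (assoc (tmul L w d)) =
        ev (atPoint q.1.l (p.1 d)) (assoc.symm
          (map LinearMap.id (Coring.comul (A := A) (C := C)).l w)) := fun w => by
      induction w using BTensor.induction_on with
      | tm c' c'' =>
        rw [map_tmul, LinearMap.id_apply, ev_assoc_symm, BimodHom.l_apply, q.2]
        rfl
      | plus v w hv hw => rw [add_tmul, map_add, map_add, map_add, map_add, map_add, hv, hw]
    rw [blackAux_tmul, ← q.2]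
    refine (ev_map (atPoint q.1.l (p.1 d)) (Coring.comul (A := A) (C := C)).r
      (Coring.comul (A := A) c)).trans ?_
    refine Eq.trans ?_ (h1 (Coring.comul (A := A) c)).symm
    rw [← Coring.coassoc, AddEquiv.symm_apply_apply]
  | plus v w hv hw =>
    have h2 := map_add (blackAux X q p).1 v w
    have h3 := map_add (Coring.comul (A := A) (C := C)).1
      (blackAux X q p v) (blackAux X q p w)
    rw [h2, h3, hv, hw, map_add, map_add, map_add]

theorem tau_blackAux {h : IsPure A C L D} (q : QTilde L X) (p : homD h X) (z : C ⊗ᴮ[L] D) :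
    tauL A C L D (blackAux X q p z) = map (blackAux X q p).r LinearMap.id
      (assoc.symm (map LinearMap.id (Coring.comul (A := L) (C := D)).l z)) := by
  induction z using BTensor.induction_on with
  | tm c d =>
    rw [blackAux_tmul, evDual_map]
    have h1 : map LinearMap.id (tauL A C L D) (X.coact (p.1 d)) =
        assoc (map (coactL L X) LinearMap.id (map p.1.r LinearMap.id
          (Coring.comul (A := L) (C := D) d))) := by
      rw [← p.2, coactD_spec, AddEquiv.apply_symm_apply]
    rw [h1, map_tmul, BimodHom.l_apply, LinearMap.id_apply]
    generalize (Coring.comul (A := L) (C := D)) d = u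
    induction u using BTensor.induction_on with
    | tm d' d'' =>
      rw [map_tmul, map_tmul, assoc_symm_tmul, map_tmul, BimodHom.r_apply, BimodHom.r_apply,
        blackAux_tmul]
      change evDual (q.1 c) (assoc (tmul L (X.coact (p.1 d')) d'')) = _
      generalize X.coact (p.1 d') = w
      induction w using BTensor.induction_on with
      | tm x n => rfl
      | plus v w hv hw => rw [add_tmul, map_add, map_add, map_add, add_tmul, hv, hw]
    | plus v w hv hw => rw [tmul_add, map_add, map_add, map_add, map_add, map_add, map_add, hv, hw]
  | plus v w hv hw =>
    have h2 := map_add (blackAux X q p).1 v w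
    rw [h2, map_add, hv, hw, map_add, map_add, map_add]

/-- The first connecting map:
`(q ◆ p)(c) = q(c₀)(p(c₁)⁰) p(c₁)¹`, which equals `c¹ q(c²₀)(p(c²₁))`. -/
def blackDiamond {h : IsPure A C L D} (q : QTilde L X) (p : homD h X) : endCD A C L D :=
  ⟨⟨(blackAux X q p).1.comp (RightExtension.tau (A := A) (C := C) (L := L) (D := D)).1,
    fun a c => by
      rw [AddMonoidHom.comp_apply, AddMonoidHom.comp_apply,
        (RightExtension.tau (A := A) (C := C) (L := L) (D := D)).2.1, (blackAux X q p).2.1],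
    fun l c => by
      rw [AddMonoidHom.comp_apply, AddMonoidHom.comp_apply,
        (RightExtension.tau (A := A) (C := C) (L := L) (D := D)).2.2, (blackAux X q p).2.2]⟩,
    fun c => by
      refine (comul_blackAux X q p (tauL A C L D c)).trans ?_
      refine (congrArg _ (RightExtension.comul_colinear (A := A) (L := L) (D := D) c)).trans ?_
      rw [map_map]
      rfl,
    fun c => by
      refine (tau_blackAux X q p (tauL A C L D c)).trans ?_
      have h1 := RightExtension.coassoc (A := A) (L := L) (D := D) c
      rw [← AddEquiv.eq_symm_apply] at h1
      refine (congrArg _ h1.symm).trans ?_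
      rw [map_map]
      rfl⟩

theorem blackDiamond_add_right {h : IsPure A C L D} (q : QTilde L X) (p p' : homD h X) :
    blackDiamond X q (p + p') = blackDiamond X q p + blackDiamond X q p' := by
  refine Subtype.ext (Subtype.ext (AddMonoidHom.ext fun c => ?_))
  change blackAdd X q (p + p') (tauL A C L D c) =
    blackAdd X q p (tauL A C L D c) + blackAdd X q p' (tauL A C L D c)
  generalize tauL A C L D c = z
  induction z using BTensor.induction_on with
  | tm c d =>
    exact map_add ((evDual (q.1 c)).comp X.coact.toAddMonoidHom) (p.1 d) (p'.1 d)
  | plus v w hv hw => rw [map_add, map_add, map_add, hv, hw]; abel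

theorem blackDiamond_add_left {h : IsPure A C L D} (q q' : QTilde L X) (p : homD h X) :
    blackDiamond X (q + q') p = blackDiamond X q p + blackDiamond X q' p := by
  refine Subtype.ext (Subtype.ext (AddMonoidHom.ext fun c => ?_))
  change blackAdd X (q + q') p (tauL A C L D c) =
    blackAdd X q p (tauL A C L D c) + blackAdd X q' p (tauL A C L D c)
  generalize tauL A C L D c = z
  induction z using BTensor.induction_on with
  | tm c d => exact map_add (evDualHom (X.coact (p.1 d))) (q.1 c) (q'.1 c)
  | plus v w hv hw => rw [map_add, map_add, map_add, hv, hw]; abel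

theorem diamond_add_left {h : IsPure A C L D} (p p' : homD h X) (q : QTilde L X) :
    diamond X (p + p') q = diamond X p q + diamond X p' q :=
  Subtype.ext (AddMonoidHom.ext fun d => Subtype.ext
    (congrArg Subtype.val (map_add (actQ X q X) (p.1 d) (p'.1 d))))

theorem diamond_add_right {h : IsPure A C L D} (p : homD h X) (q q' : QTilde L X) :
    diamond X p (q + q') = diamond X p q + diamond X p q' :=
  Subtype.ext (AddMonoidHom.ext fun d => Subtype.ext (LinearMap.ext fun x =>
    map_add ((evHom (X.coact (p.1 d))).comp (atPointHom L x)) q.1 q'.1))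

/-- The connecting map `Q̃ ⊗ _L Hom^D(D, X) → ^C End^D(C)`, `q ⊗ p ↦ q ◆ p`. It is balanced over
`_L Hom_L(D, T)`; passing to the balanced tensor product, which is a quotient of `⊗ ℤ`, does not
change the image. -/
def blackDiamondHom (h : IsPure A C L D) :
    TensorProduct ℤ (QTilde L X) (homD h X) →+ endCD A C L D :=
  TensorProduct.liftAddHom (R := ℤ)
    (AddMonoidHom.mk' (fun q => AddMonoidHom.mk' (fun p => blackDiamond X q p)
      (blackDiamond_add_right X q))
      (fun q q' => AddMonoidHom.ext fun p => blackDiamond_add_left X q q' p))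
    (fun r q p => by rw [map_zsmul, map_zsmul]; rfl)

/-- The connecting map `_L Hom^D(D, X) ⊗ Q̃ → _L Hom_L(D, T)`, `p ⊗ q ↦ p ◇ q`. It is balanced over
`^C End^D(C)`; passing to the balanced tensor product, which is a quotient of `⊗ ℤ`, does not
change the image. -/
def diamondHom (h : IsPure A C L D) :
    TensorProduct ℤ (homD h X) (QTilde L X) →+ BimodHom L L D X.endC :=
  TensorProduct.liftAddHom (R := ℤ)
    (AddMonoidHom.mk' (fun p => AddMonoidHom.mk' (fun q => diamond X p q)
      (diamond_add_right X p))
      (fun p p' => AddMonoidHom.ext fun q => diamond_add_left X p p' q))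
    (fun r q p => by rw [map_zsmul, map_zsmul]; rfl)

/-- The Morita context of `X` is strict: both connecting maps are surjective. -/
def IsStrict (h : IsPure A C L D) : Prop :=
  Function.Surjective (blackDiamondHom X h) ∧ Function.Surjective (diamondHom X h)

end Extensions

end CoringExt

end

open CategoryTheory MulOpposite CoringExt

/-!
Write `T = End^C(X)`. The functor `- ⊗_T X` is left adjoint to `Hom^C(X, -)`, with unit
`n ↦ (x ↦ n ⊗ x)` and counit `f ⊗ x ↦ f x`, so it suffices that both are bijective.

The elements `x q(-)` with `q ∈ Q̃` span a left ideal of `T`, the trace ideal. For `t = x q(-)` and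
`f : X → N ⊗_T X` colinear, `f t = f(x) q(-)` is the image under the unit of the element of `N`
obtained by applying `q(-)` to the second factor of `f(x)`; and an element of the kernel of the
unit is annihilated by `t`. Hence the unit is bijective as soon as the trace ideal is all of `T`.
The values of any map in the image of `Hom(D, X) ⊗ Q̃` lie in the trace ideal, so surjectivity of
this connecting map and `∑ v_j(d_j) = 1` suffice.

For the counit, purity gives every comodule `M` a `D`-coaction `m ↦ m_[0] ⊗ m_[1]`, and a pair
`q, p` yields the map `m ↦ m_[0] q(-) ⊗ p(m_[1])` backwards. Both composites with the counit are
given by the action of the endomorphism `q ◆ p` of `C`, on `M` and on the factor `X` respectively;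
when `∑ q ◆ p` is the identity of `C`, the sum of these maps is inverse to the counit.
-/

noncomputable section

namespace CoringExt

open RightComodule BTensor

theorem BTensor.assoc_symm_map_left {R S : Type*} [Ring R] [Ring S] {M M' N Q : Type*}
    [AddCommGroup M] [Module Rᵐᵒᵖ M] [AddCommGroup M'] [Module Rᵐᵒᵖ M'] [AddCommGroup N]
    [Module R N] [Module Sᵐᵒᵖ N] [SMulCommClass R Sᵐᵒᵖ N] [AddCommGroup Q] [Module S Q]
    (f : M →ₗ[Rᵐᵒᵖ] M') (z : M ⊗ᴮ[R] (N ⊗ᴮ[S] Q)) :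
    assoc.symm (map f LinearMap.id z) = map (mapR f (LinearMap.id : N →ₗ[R] N) (fun _ _ => rfl))
      LinearMap.id (assoc.symm z) := by
  rw [AddEquiv.symm_apply_eq, assoc_map_left, AddEquiv.apply_symm_apply]

section Adjunction

variable {A C : Type u} [Ring A] [AddCommGroup C] [Module A C] [Module Aᵐᵒᵖ C]
  [SMulCommClass A Aᵐᵒᵖ C] [Coring A C]

/-- The unit `n ↦ (x ↦ n ⊗ x)` of the adjunction `- ⊗_T X ⊣ Hom^C(X, -)`. -/
def indUnit (X : RightComodule A C) (N : ModuleCat.{u} X.endCᵐᵒᵖ) :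
    N →ₗ[X.endCᵐᵒᵖ] homC X (indObj X N) where
  toFun n := ⟨tmulHom X N n, indCoact_tmul X N n⟩
  map_add' n n' := Subtype.ext (LinearMap.ext fun x => add_tmul n n' x)
  map_smul' t n := Subtype.ext (LinearMap.ext fun x => smul_tmul t.unop n x)

/-- The map `n ⊗ x ↦ φ(n)(x)` from `N ⊗_T X` to `M` adjoint to `φ : N → Hom^C(X, M)`. -/
def indLift {X M : RightComodule A C} {N : ModuleCat.{u} X.endCᵐᵒᵖ}
    (φ : N →ₗ[X.endCᵐᵒᵖ] homC X M) : N ⊗ᴮ[X.endC] X →ₗ[Aᵐᵒᵖ] M where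
  toFun := BTensor.lift (fun n x => (φ n).1 x) (fun n n' x => by rw [map_add]; rfl)
    (fun n => map_add (φ n).1) (fun t n x => by rw [map_smul]; rfl)
  map_add' := map_add _
  map_smul' a z := by
    induction z using BTensor.induction_on with
    | tm n x => exact map_smul (φ n).1 a x
    | plus v w hv hw => rw [smul_add, map_add, map_add, hv, hw, smul_add]

theorem indLift_comp_tmulHom {X M : RightComodule A C} {N : ModuleCat.{u} X.endCᵐᵒᵖ}
    (φ : N →ₗ[X.endCᵐᵒᵖ] homC X M) (n : N) : indLift φ ∘ₗ tmulHom X N n = (φ n).1 := rfl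

theorem coact_indLift {X M : RightComodule A C} {N : ModuleCat.{u} X.endCᵐᵒᵖ}
    (φ : N →ₗ[X.endCᵐᵒᵖ] homC X M) (z : N ⊗ᴮ[X.endC] X) :
    M.coact (indLift φ z) = map (indLift φ) LinearMap.id (indCoact X N z) := by
  induction z using BTensor.induction_on with
  | tm n x =>
    rw [indCoact_tmul, map_map, indLift_comp_tmulHom]
    exact (φ n).2 x
  | plus v w hv hw => rw [map_add, map_add, map_add, map_add, hv, hw]

/-- The counit `f ⊗ x ↦ f x` of the adjunction `- ⊗_T X ⊣ Hom^C(X, -)`. -/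
def eval (X M : RightComodule A C) : homC X M ⊗ᴮ[X.endC] X →ₗ[Aᵐᵒᵖ] M :=
  indLift (N := (coinvFunctor X).obj M) LinearMap.id

@[simp] theorem eval_tmul {X M : RightComodule A C} (f : homC X M) (x : X) :
    eval X M (tmul X.endC f x) = f.1 x := rfl

/-- The functors `- ⊗_T X` and `Hom^C(X, -)` are adjoint. -/
def indAdjunction (X : RightComodule A C) : indFunctor X ⊣ coinvFunctor X where
  unit := { app := fun N => ModuleCat.ofHom (indUnit X N) }
  counit :=
    { app := fun M => ⟨eval X M, coact_indLift (N := (coinvFunctor X).obj M) LinearMap.id⟩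
      naturality := fun M M' f => Subtype.ext <| LinearMap.toAddMonoidHom_injective <|
        BTensor.hom_ext (M := homC X M) fun g x => rfl }
  left_triangle_components N := Subtype.ext <| LinearMap.toAddMonoidHom_injective <|
    BTensor.hom_ext fun n x => rfl

theorem isIso_of_bijective {M N : RightComodule A C} (f : M ⟶ N)
    (hf : Function.Bijective f.1) : IsIso f := by
  let e : M ≃ₗ[Aᵐᵒᵖ] N := LinearEquiv.ofBijective f.1 hf
  have he : e.symm.toLinearMap ∈ homC N M := fun n => by
    obtain ⟨m, rfl⟩ := e.surjective n
    have hm : N.coact (e m) = map e.toLinearMap LinearMap.id (M.coact m) := f.2 m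
    rw [hm, map_map, LinearEquiv.symm_comp, LinearMap.comp_id, map_id]
    exact congrArg M.coact (e.symm_apply_apply m)
  exact ⟨⟨e.symm.toLinearMap, he⟩, Subtype.ext (LinearMap.ext e.symm_apply_apply),
    Subtype.ext (LinearMap.ext e.apply_symm_apply)⟩

theorem hom_ev_coact {M N : RightComodule A C} (f : homC M N) (g : C →ₗ[A] A) (m : M) :
    f.1 (ev g (M.coact m)) = ev g (N.coact (f.1 m)) := by
  rw [ev_map, f.2 m]

end Adjunction

variable {A C L D : Type u} [Ring A] [AddCommGroup C] [Module A C] [Module Aᵐᵒᵖ C]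
  [SMulCommClass A Aᵐᵒᵖ C] [Coring A C] [Ring L] [Module Lᵐᵒᵖ C] [SMulCommClass A Lᵐᵒᵖ C]
  [ComulRightLinear A C L]

section Trace

variable {X : RightComodule A C} [Module L X] [SMulCommClass L Aᵐᵒᵖ X] [Bicomodule L X]

theorem actQ_hom (q : QTilde L X) {M N : RightComodule A C} (f : homC M N) (m : M) :
    (actQ X q N (f.1 m)).1 = f.1 ∘ₗ (actQ X q M m).1 :=
  LinearMap.ext fun x => (hom_ev_coact f (atPoint q.1.l x) m).symm

variable (X) in
/-- For `q` in `Q̃`, the left `T`-linear map `x ↦ x q(-)` from `X` to `T = End^C(X)`. It is `actQ`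
for the comodule `X` itself, with values in the ring `T` rather than in the group `Hom^C(X, X)`. -/
def endQ (q : QTilde L X) : X →ₗ[X.endC] X.endC where
  toFun x := ⟨(actQ X q X x).1, (actQ X q X x).2⟩
  map_add' x y := Subtype.ext (congrArg Subtype.val (map_add (actQ X q X) x y))
  map_smul' t x := Subtype.ext (actQ_hom q (M := X) (N := X) ⟨t.1, t.2⟩ x)

theorem actQ_hom_eq_smul (q : QTilde L X) {M : RightComodule A C} (f : homC X M) (x : X) :
    actQ X q M (f.1 x) = op (endQ X q x) • f :=
  Subtype.ext (actQ_hom q f x)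

/-- The map `n ⊗ x ↦ n (x q(-))` from `N ⊗_T X` to `N`. -/
def contract (q : QTilde L X) (N : ModuleCat.{u} X.endCᵐᵒᵖ) : N ⊗ᴮ[X.endC] X →+ N :=
  rid.comp (map LinearMap.id (endQ X q))

theorem contract_tmul (q : QTilde L X) (N : ModuleCat.{u} X.endCᵐᵒᵖ) (n : N) (x : X) :
    contract q N (tmul X.endC n x) = op (endQ X q x) • n := rfl

theorem actQ_indObj (q : QTilde L X) (N : ModuleCat.{u} X.endCᵐᵒᵖ) (z : N ⊗ᴮ[X.endC] X) :
    actQ X q (indObj X N) z = indUnit X N (contract q N z) := by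
  induction z using BTensor.induction_on with
  | tm n x =>
    rw [contract_tmul, map_smul]
    exact actQ_hom_eq_smul q (indUnit X N n) x
  | plus v w hv hw =>
    rw [map_add (contract q N), map_add (indUnit X N), ← hv, ← hw]
    exact map_add (actQ X q (indObj X N)) v w

variable (L X) in
/-- The trace ideal of `X` in `T = End^C(X)`: the image of `x ⊗ q ↦ x q(-)` on `X ⊗ Q̃`. -/
def traceIdeal : Ideal X.endC := ⨆ q : QTilde L X, LinearMap.range (endQ X q)

theorem endQ_mem_traceIdeal (q : QTilde L X) (x : X) : endQ X q x ∈ traceIdeal L X :=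
  Submodule.mem_iSup_of_mem q ⟨x, rfl⟩

theorem op_smul_eq_zero_of_mem_traceIdeal {N : ModuleCat.{u} X.endCᵐᵒᵖ} {n : N}
    (hn : indUnit X N n = 0) {t : X.endC} (ht : t ∈ traceIdeal L X) : op t • n = 0 := by
  induction ht using Submodule.iSup_induction' with
  | mem q _ hs =>
    obtain ⟨x, rfl⟩ := hs
    have hx : tmul X.endC n x = 0 := congrArg (fun f => f.1 x) hn
    rw [← contract_tmul, hx, map_zero]
  | zero => rw [MulOpposite.op_zero, zero_smul]
  | add s t _ _ hs ht => rw [MulOpposite.op_add, add_smul, hs, ht, add_zero]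

theorem op_smul_mem_range_indUnit {N : ModuleCat.{u} X.endCᵐᵒᵖ} (f : homC X (indObj X N))
    {t : X.endC} (ht : t ∈ traceIdeal L X) : op t • f ∈ LinearMap.range (indUnit X N) := by
  induction ht using Submodule.iSup_induction' with
  | mem q _ hs =>
    obtain ⟨x, rfl⟩ := hs
    rw [← actQ_hom_eq_smul]
    exact ⟨contract q N (f.1 x), (actQ_indObj q N (f.1 x)).symm⟩
  | zero => rw [MulOpposite.op_zero, zero_smul]; exact zero_mem _
  | add s t _ _ hs ht => rw [MulOpposite.op_add, add_smul]; exact add_mem hs ht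

theorem indUnit_bijective (hX : traceIdeal L X = ⊤) (N : ModuleCat.{u} X.endCᵐᵒᵖ) :
    Function.Bijective (indUnit X N) := by
  have one_mem : (1 : X.endC) ∈ traceIdeal L X := hX ▸ Submodule.mem_top
  refine ⟨(injective_iff_map_eq_zero _).2 fun n hn => ?_, fun f => ?_⟩
  · simpa only [MulOpposite.op_one, one_smul] using op_smul_eq_zero_of_mem_traceIdeal hn one_mem
  · simpa only [MulOpposite.op_one, one_smul, LinearMap.mem_range] using
      op_smul_mem_range_indUnit f one_mem

end Trace

variable (L) in
/-- A `C`-colinear map as a right `L`-linear map. -/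
def homL {M N : RightComodule A C} (f : homC M N) : M →ₗ[Lᵐᵒᵖ] N where
  toFun := f.1
  map_add' := map_add f.1
  map_smul' l m := by
    rw [induced_smul, induced_smul, ev_map, f.2 m, RingHom.id_apply]
    exact congrArg (ev (counitL A C))
      (map_smul (mapR f.1 (LinearMap.id : C →ₗ[A] C) (fun _ _ => rfl)) l (M.coact m))

theorem actQ_op_smul {X : RightComodule A C} [Module L X] [SMulCommClass L Aᵐᵒᵖ X]
    [Bicomodule L X] (q : QTilde L X) (M : RightComodule A C) (l : L) (m : M) :
    actQ X q M (op l • m) = op (unitMap L X l) • actQ X q M m := by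
  refine Subtype.ext (LinearMap.ext fun x => ?_)
  change ev (atPoint q.1.l x) (coactL L M (op l • m)) =
    ev (atPoint q.1.l (l • x)) (coactL L M m)
  rw [map_smul]
  generalize coactL L M m = w
  induction w using BTensor.induction_on with
  | tm y c => exact congrArg (fun ξ : dual X => op (ξ x) • y) (q.1.2.2 l c)
  | plus v w hv hw => rw [smul_add, map_add, map_add, hv, hw]

variable [AddCommGroup D] [Module L D] [Module Lᵐᵒᵖ D]

section Splitting

variable {X : RightComodule A C} [Module L X] [SMulCommClass L Aᵐᵒᵖ X]

/-- The left `A`-linear map `c ⊗ d ↦ q(c)(p(d))`. -/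
def pairing (q : BimodHom A L C (dual X)) (p : BimodHom L L D X) : C ⊗ᴮ[L] D →ₗ[A] A where
  toFun := BTensor.lift (fun c d => q c (p d))
    (fun c c' d => by rw [map_add]; rfl) (fun c d d' => by rw [map_add, map_add])
    (fun l c d => by rw [q.2.2, p.2.1]; rfl)
  map_add' := map_add _
  map_smul' a z := by
    induction z using BTensor.induction_on with
    | tm c d => exact congrArg (fun ξ : dual X => ξ (p d)) (q.2.1 a c)
    | plus v w hv hw => rw [smul_add, map_add, map_add, hv, hw, smul_add]

variable [Bicomodule L X]

/-- The map `m ⊗ d ↦ m q(-) ⊗ p(d)` from `M ⊗_L D` to `Hom^C(X, M) ⊗_T X`. Composed with the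
`D`-coaction of `M` and summed over suitable `q` and `p`, it is inverse to `eval`. -/
def splitting (q : QTilde L X) (p : BimodHom L L D X) (M : RightComodule A C) :
    M ⊗ᴮ[L] D →+ homC X M ⊗ᴮ[X.endC] X :=
  BTensor.lift (fun m d => tmul X.endC (actQ X q M m) (p d))
    (fun m m' d => by rw [map_add, add_tmul])
    (fun m d d' => by rw [map_add, tmul_add])
    (fun l m d => by rw [actQ_op_smul, smul_tmul, p.2.1]; rfl)

theorem eval_splitting (q : QTilde L X) (p : BimodHom L L D X) (M : RightComodule A C)
    (z : M ⊗ᴮ[L] D) : eval X M (splitting q p M z) =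
      rid (map LinearMap.id (pairing q.1 p) (assoc (map (coactL L M) LinearMap.id z))) := by
  induction z using BTensor.induction_on with
  | tm m d =>
    change ev (atPoint q.1.l (p d)) (M.coact m) =
      rid (map LinearMap.id (pairing q.1 p) (assoc (tmul L (M.coact m) d)))
    generalize M.coact m = w
    induction w using BTensor.induction_on with
    | tm y c => rfl
    | plus v w hv hw => simp only [add_tmul, map_add, hv, hw]
  | plus v w hv hw => simp only [map_add, hv, hw]

theorem splitting_map_homL (q : QTilde L X) (p : BimodHom L L D X) {M : RightComodule A C}
    (f : homC X M) (z : X ⊗ᴮ[L] D) :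
    splitting q p M (map (homL L f) LinearMap.id z) =
      tmul X.endC f (eval X X (splitting q p X z)) := by
  induction z using BTensor.induction_on with
  | tm x d =>
    change tmul X.endC (actQ X q M (f.1 x)) (p d) = tmul X.endC f (endQ X q x • p d)
    rw [actQ_hom_eq_smul, smul_tmul]
  | plus v w hv hw => simp only [map_add, tmul_add, hv, hw]

end Splitting

/-- The right action of the endomorphisms of `C` on a comodule `M`: `u` acts as
`m ↦ m⁰ ε(u(m¹))`, which is linear over `End^C(M)`. -/
def endAct (M : RightComodule A C) : BimodHom A L C C →+ (M →ₗ[M.endC] M) :=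
  AddMonoidHom.mk' (fun u =>
    { toFun := fun m => ev (counitL A C ∘ₗ u.l) (M.coact m)
      map_add' := fun m m' => by rw [map_add, map_add]
      map_smul' := fun t m => (hom_ev_coact (M := M) (N := M) ⟨t.1, t.2⟩ _ m).symm })
    fun u v => LinearMap.ext fun m =>
      (congrArg (evHom (M.coact m)) (LinearMap.comp_add u.l v.l (counitL A C))).trans
        (map_add (evHom (M.coact m)) _ _)

variable [SMulCommClass L Lᵐᵒᵖ D] [Coring L D] [RightExtension A C L D]

/-- The identity of `C` is the unit of the algebra `^C End^D(C)`. -/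
instance : One (endCD A C L D) :=
  ⟨⟨AddMonoidHom.id C, fun _ _ => rfl, fun _ _ => rfl⟩, fun _ => (map_id _).symm,
    fun _ => (map_id _).symm⟩

theorem endAct_one (M : RightComodule A C) :
    endAct M (1 : endCD A C L D).1 = LinearMap.id :=
  LinearMap.ext M.coact_counit

theorem coactD_hom (h : IsPure A C L D) {M N : RightComodule A C} (f : homC M N) (m : M) :
    coactD h N (f.1 m) = map (homL L f) LinearMap.id (coactD h M m) := by
  apply (h.preserves N).1
  have colinear : coactL L N ∘ₗ homL L f =
      mapR f.1 (LinearMap.id : C →ₗ[A] C) (fun _ _ => rfl) ∘ₗ coactL L M := LinearMap.ext f.2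
  have swap : map LinearMap.id (tauL A C L D) (map f.1 LinearMap.id (M.coact m)) =
      map f.1 LinearMap.id (map LinearMap.id (tauL A C L D) (M.coact m)) := by
    rw [map_map, map_map]; rfl
  rw [coactD_spec, f.2 m, swap, assoc_symm_map_left, ← coactD_spec h M m, map_map, map_map,
    colinear]

section Counit

variable {X : RightComodule A C} [Module L X] [SMulCommClass L Aᵐᵒᵖ X]

theorem counit_evDual_coact (ξ : dual X) (x : X) :
    counitL A C (evDual ξ (X.coact x)) = ξ x := by
  rw [evDual_map]
  generalize hw : map LinearMap.id (counitL A C) (X.coact x) = w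
  have evDual_eq : evDual ξ w = ξ (rid w) := by
    clear hw
    induction w using BTensor.induction_on with
    | tm y a => exact (map_smul ξ (op a) y).symm
    | plus v w hv hw => simp only [map_add, hv, hw]
  rw [evDual_eq, ← hw, X.coact_counit]

variable [Bicomodule L X] {h : IsPure A C L D}

theorem counit_comp_blackDiamond (q : QTilde L X) (p : homD h X) :
    counitL A C ∘ₗ (blackDiamond X q p).1.l = pairing q.1 p.1 ∘ₗ tauL A C L D := by
  refine LinearMap.ext fun c => ?_
  change counitL A C (blackAdd X q p (tauL A C L D c)) = pairing q.1 p.1 (tauL A C L D c)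
  generalize tauL A C L D c = z
  induction z using BTensor.induction_on with
  | tm c d => exact counit_evDual_coact (q.1 c) (p.1 d)
  | plus v w hv hw => rw [map_add, map_add, map_add, hv, hw]

theorem eval_splitting_coactD (q : QTilde L X) (p : homD h X) (M : RightComodule A C) (m : M) :
    eval X M (splitting q p.1 M (coactD h M m)) = endAct M (blackDiamond X q p).1 m := by
  rw [eval_splitting, coactD_spec, AddEquiv.apply_symm_apply, map_map, ← counit_comp_blackDiamond]
  rfl

theorem splitting_coactD_eval (q : QTilde L X) (p : homD h X) {M : RightComodule A C}
    (z : homC X M ⊗ᴮ[X.endC] X) :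
    splitting q p.1 M (coactD h M (eval X M z)) =
      map LinearMap.id (endAct X (blackDiamond X q p).1) z := by
  induction z using BTensor.induction_on with
  | tm f x => rw [eval_tmul, coactD_hom, splitting_map_homL, eval_splitting_coactD, map_tmul]; rfl
  | plus v w hv hw => simp only [map_add, hv, hw]

variable (h) in
theorem endAct_mem_range_eval (t : TensorProduct ℤ (QTilde L X) (homD h X)) {M : RightComodule A C}
    (m : M) : endAct M (blackDiamondHom X h t).1 m ∈ LinearMap.range (eval X M) := by
  induction t using TensorProduct.induction_on with
  | zero => rw [map_zero, AddSubgroup.coe_zero, map_zero]; exact zero_mem _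
  | tmul q p => exact ⟨_, eval_splitting_coactD q p M m⟩
  | add s t hs ht =>
    rw [map_add, AddSubgroup.coe_add, map_add]
    exact add_mem hs ht

theorem map_endAct_eq_zero (t : TensorProduct ℤ (QTilde L X) (homD h X)) {M : RightComodule A C}
    {z : homC X M ⊗ᴮ[X.endC] X} (hz : eval X M z = 0) :
    map LinearMap.id (endAct X (blackDiamondHom X h t).1) z = 0 := by
  induction t using TensorProduct.induction_on with
  | zero =>
    rw [map_zero, AddSubgroup.coe_zero, map_zero]
    exact (mapRightHom LinearMap.id z).map_zero
  | tmul q p =>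
    refine (splitting_coactD_eval q p z).symm.trans ?_
    rw [hz, map_zero, map_zero]
  | add s t hs ht =>
    rw [map_add, AddSubgroup.coe_add, map_add, map_add_right, hs, ht, add_zero]

theorem eval_bijective (h1 : 1 ∈ (blackDiamondHom X h).range) (M : RightComodule A C) :
    Function.Bijective (eval X M) := by
  obtain ⟨t, ht⟩ := h1
  refine ⟨(injective_iff_map_eq_zero _).2 fun z hz => ?_, fun m => ?_⟩
  · simpa only [ht, endAct_one, map_id] using map_endAct_eq_zero t hz
  · simpa only [ht, endAct_one, LinearMap.id_apply, LinearMap.mem_range] using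
      endAct_mem_range_eval h t m

end Counit

theorem diamondHom_apply_mem_traceIdeal {X : RightComodule A C} [Module L X]
    [SMulCommClass L Aᵐᵒᵖ X] [Bicomodule L X] {h : IsPure A C L D}
    (t : TensorProduct ℤ (homD h X) (QTilde L X)) (d : D) :
    diamondHom X h t d ∈ traceIdeal L X := by
  induction t using TensorProduct.induction_on with
  | zero => rw [map_zero]; exact zero_mem _
  | tmul p q => exact endQ_mem_traceIdeal q (p.1 d)
  | add s t hs ht => rw [map_add]; exact add_mem hs ht

end CoringExt

end

theorem mainTheorem5_general {A C L D : Type u} [Ring A] [Ring L]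
    [AddCommGroup C] [Module A C] [Module Aᵐᵒᵖ C] [SMulCommClass A Aᵐᵒᵖ C] [Coring A C]
    [AddCommGroup D] [Module L D] [Module Lᵐᵒᵖ D] [SMulCommClass L Lᵐᵒᵖ D] [Coring L D]
    [Module Lᵐᵒᵖ C] [SMulCommClass A Lᵐᵒᵖ C] [ComulRightLinear A C L] [RightExtension A C L D]
    (hpure : IsPure A C L D) (X : RightComodule A C) [Module L X] [SMulCommClass L Aᵐᵒᵖ X]
    [Bicomodule L X] (hblack : 1 ∈ (blackDiamondHom X hpure).range)
    (htrace : traceIdeal L X = ⊤) :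
    ∃ e : ModuleCat.{u} X.endCᵐᵒᵖ ≌ RightComodule A C,
      e.functor = indFunctor X ∧ e.inverse = coinvFunctor X := by
  have (N : ModuleCat X.endCᵐᵒᵖ) : IsIso ((indAdjunction X).unit.app N) :=
    (ConcreteCategory.isIso_iff_bijective _).2 (indUnit_bijective htrace N)
  have (M : RightComodule A C) : IsIso ((indAdjunction X).counit.app M) :=
    isIso_of_bijective _ (eval_bijective hblack M)
  exact ⟨(indAdjunction X).toEquivalence, rfl, rfl⟩

/-- **Strong Structure Theorem.** Let `C` be an `A`-coring, `D` an `L`-coring which is a pure right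
extension of `C`, and `X` an `L`-`C` bicomodule with `T = End^C(X)`. If the Morita context of `X` is
strict and `1 = ∑ j, v j (d j)` in `T` for some `v j ∈ _L Hom_L(D, T)` and `d j ∈ D`, then
`- ⊗_T X` and `Hom^C(X, -)` are inverse equivalences. -/
theorem mainTheorem5 {k : Type*} [CommRing k] {A C L D : Type u}
    [Ring A] [Algebra k A] [Ring L] [Algebra k L]
    [AddCommGroup C] [Module k C] [Module A C] [Module Aᵐᵒᵖ C] [SMulCommClass A Aᵐᵒᵖ C]
    [IsScalarTower k A C] [IsScalarTower k Aᵐᵒᵖ C] [Coring A C]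
    [AddCommGroup D] [Module k D] [Module L D] [Module Lᵐᵒᵖ D] [SMulCommClass L Lᵐᵒᵖ D]
    [IsScalarTower k L D] [IsScalarTower k Lᵐᵒᵖ D] [Coring L D]
    [Module Lᵐᵒᵖ C] [SMulCommClass A Lᵐᵒᵖ C] [IsScalarTower k Lᵐᵒᵖ C]
    [ComulRightLinear A C L] [RightExtension A C L D] (hpure : IsPure A C L D)
    (X : RightComodule A C) [Module k X] [Module L X] [SMulCommClass L Aᵐᵒᵖ X]
    [IsScalarTower k L X] [IsScalarTower k Aᵐᵒᵖ X] [Bicomodule L X]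
    (hstrict : IsStrict X hpure)
    (hunit : ∃ (n : ℕ) (v : Fin n → BimodHom L L D X.endC) (d : Fin n → D),
      ∑ j, v j (d j) = 1) :
    ∃ e : ModuleCat.{u} X.endCᵐᵒᵖ ≌ RightComodule A C,
      e.functor = indFunctor X ∧ e.inverse = coinvFunctor X := by
  refine mainTheorem5_general hpure X (hstrict.1 1) ((Ideal.eq_top_iff_one _).2 ?_)
  obtain ⟨n, v, d, hvd⟩ := hunit
  rw [← hvd]
  refine sum_mem fun j _ => ?_
  obtain ⟨t, ht⟩ := hstrict.2 (v j)
  exact ht ▸ diamondHom_apply_mem_traceIdeal t (d j)
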